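/- Let $(M,g_0)$ be a compact connected smooth $4$-dimensional Riemannian manifold without boundary. Let $u_k$ $(k\in\mathbb N)$ be smooth positive functions on $M$ and let $g_k=u_k^2g_0$ be the corresponding conformal metrics, normalized by $\mathrm{Vol}(M,g_k)=1$ for all $k$. Let $x_k\in M$ and $r_k>0$ with $r_k\to 0$. Write $B_r(x)$ for the open ball of radius $r$ about $x$ with respect to the distance of $g_0$, and $\mathrm{Vol}(A,g_k)$ for the Riemannian volume of $A$ with respect to $g_k$. Suppose that $$\lim_{R\to+\infty}\liminf_{k\to\infty}\mathrm{Vol}(B_{Rr_k}(x_k),g_k)>0\quad\text{and}\quad \lim_{R\to+\infty}\liminf_{k\to\infty}\mathrm{Vol}(M\setminus B_{Rr_k}(x_k),g_k)>0 .$$ Then $\lambda_1(\Delta_{g_k})\to 0$ as $k\to\infty$, where $\lambda_1(\Delta_{g})$ denotes the first eigenvalue of the Laplacian of $g$, that is, the smallest positive $\lambda$ for which $-\Delta_{g}w=\lambda w$ has a nonzero solution $w$ (in the weak sense in $W^{1,2}(M,g)$); this smallest positive eigenvalue exists. -/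

import Mathlib

open Filter Topology MeasureTheory Bundle Manifold
open scoped ContDiff ENNReal

noncomputable section

namespace ConformalPinching

/-- Smooth Riemannian metrics on the `n`-dimensional manifold (without boundary) `M`. -/
abbrev SmoothMetric (n : ℕ) (M : Type*) [TopologicalSpace M] [ChartedSpace (EuclideanSpace ℝ (Fin n)) M]
    [IsManifold (𝓡 n) ∞ M] :=
  ContMDiffRiemannianMetric (𝓡 n) ∞ (EuclideanSpace ℝ (Fin n))
    (fun p : M ↦ TangentSpace (𝓡 n) p)

variable {n : ℕ} {M : Type*} [TopologicalSpace M] [ChartedSpace (EuclideanSpace ℝ (Fin n)) M]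
  [IsManifold (𝓡 n) ∞ M]

/-- The open ball of centre `p` and radius `r` for the distance of `g`, the infimum of the
`g`-lengths of `C^1` paths. -/
def geodesicBall (g : SmoothMetric n M) (p : M) (r : ℝ) : Set M :=
  letI : RiemannianBundle (fun q : M ↦ TangentSpace (𝓡 n) q) := ⟨g.toRiemannianMetric⟩
  {q : M | riemannianEDist (𝓡 n) p q < ENNReal.ofReal r}

/-- The coordinate vector field `∂_i` of the chart around `p`, at the point with coordinates `y`. -/
def coordVector (p : M) (y : EuclideanSpace ℝ (Fin n)) (i : Fin n) :
    TangentSpace (𝓡 n) ((extChartAt (𝓡 n) p).symm y) :=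
  mfderiv (𝓡 n) (𝓡 n) (extChartAt (𝓡 n) p).symm y (EuclideanSpace.single i (1 : ℝ))

/-- The matrix `g_ij(y) = g(∂_i, ∂_j)` in the chart around `p`. -/
def gramMatrix (g : SmoothMetric n M) (p : M) (y : EuclideanSpace ℝ (Fin n)) :
    Matrix (Fin n) (Fin n) ℝ :=
  fun i j ↦ g.inner ((extChartAt (𝓡 n) p).symm y) (coordVector p y i) (coordVector p y j)

/-- The Riemannian volume on the domain of the chart around `p`, extended by zero to `M`:
the image under the inverse of the chart of `√(det g_ij) dy`. -/
def chartVolume [MeasurableSpace M] (g : SmoothMetric n M) (p : M) : Measure M :=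
  ((volume.restrict (extChartAt (𝓡 n) p).target).withDensity
    (fun y ↦ ENNReal.ofReal (√(gramMatrix g p y).det))).map (extChartAt (𝓡 n) p).symm

/-- The Riemannian volume `dV_g`. The measures `√(det g_ij) dy` of two charts agree on the
intersection of their domains, so the least measure above all of them is the one that restricts
to `√(det g_ij) dy` on each chart domain. -/
def vol [MeasurableSpace M] (g : SmoothMetric n M) : Measure M :=
  ⨆ p : M, chartVolume g p

/-- The differential of `f` at `p`. -/
def differential (f : M → ℝ) (p : M) : TangentSpace (𝓡 n) p →L[ℝ] ℝ :=
  mfderiv (𝓡 n) 𝓘(ℝ, ℝ) f p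

theorem exists_riemGrad (g : SmoothMetric n M) (f : M → ℝ) (p : M) :
    ∃ v : TangentSpace (𝓡 n) p, ∀ w : TangentSpace (𝓡 n) p,
      g.inner p v w = differential (n := n) f p w := by
  let L : EuclideanSpace ℝ (Fin n) →ₗ[ℝ] Module.Dual ℝ (EuclideanSpace ℝ (Fin n)) :=
    { toFun := fun v ↦ (g.inner p v).toLinearMap
      map_add' := fun v w ↦ by
        ext z
        exact congrArg (fun T ↦ T z) ((g.inner p).map_add v w)
      map_smul' := fun c v ↦ by
        ext z
        exact congrArg (fun T ↦ T z) ((g.inner p).map_smul c v) }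
  have hinj : Function.Injective L := by
    rw [injective_iff_map_eq_zero]
    intro v hv
    by_contra hne
    have h1 := g.pos p v hne
    have h2 : L v v = 0 := by rw [hv]; rfl
    exact h1.ne' h2
  have hsurj : Function.Surjective L :=
    (LinearMap.injective_iff_surjective_of_finrank_eq_finrank
      (Subspace.dual_finrank_eq).symm).1 hinj
  let T : EuclideanSpace ℝ (Fin n) →L[ℝ] ℝ := differential (n := n) f p
  obtain ⟨v, hv⟩ := hsurj T.toLinearMap
  exact ⟨v, fun w ↦ congrArg (fun S ↦ S w) hv⟩

/-- The gradient of `f` for `g`: the vector `v` with `g(v, w) = df(w)` for all `w`. -/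
def riemGrad (g : SmoothMetric n M) (f : M → ℝ) (p : M) : TangentSpace (𝓡 n) p :=
  (exists_riemGrad g f p).choose

/-- The Dirichlet form `∫ g(∇f, ∇h) dV_g`. -/
def dirichletForm [MeasurableSpace M] (g : SmoothMetric n M) (f h : M → ℝ) : ℝ :=
  ∫ p, g.inner p (riemGrad g f p) (riemGrad g h p) ∂(vol g)

/-- Smooth real functions on `M`. -/
def IsSmooth (f : M → ℝ) : Prop := ContMDiff (𝓡 n) 𝓘(ℝ, ℝ) ∞ f

/-- The sequence `f` of smooth functions converges to `w` in the Sobolev space `W^{1,2}(M, g)`,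
the completion of the smooth functions (on a compact `M`) in the norm
`(∫ f^2 dV_g + ∫ |∇f|^2 dV_g)^{1/2}`, viewed inside `L^2(M, g)`. -/
structure ApproximatesSobolev [MeasurableSpace M] (g : SmoothMetric n M) (w : M → ℝ)
    (f : ℕ → M → ℝ) : Prop where
  smooth : ∀ j, IsSmooth (n := n) (f j)
  tendsto_L2 : Tendsto (fun j ↦ eLpNorm (f j - w) 2 (vol g)) atTop (𝓝 0)
  cauchy_energy : Tendsto
    (fun ij : ℕ × ℕ ↦ dirichletForm g (f ij.1 - f ij.2) (f ij.1 - f ij.2)) atTop (𝓝 0)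

/-- `lam` is an eigenvalue of (minus) the Laplacian of `g`: there is a nonzero
`w ∈ W^{1,2}(M, g)` with `-Δ_g w = lam w` weakly, that is
`∫ g(∇w, ∇φ) dV_g = lam ∫ w φ dV_g` for all smooth `φ`. The left-hand side is the limit of
`∫ g(∇f_j, ∇φ) dV_g` along smooth functions `f_j` that converge to `w` in `W^{1,2}(M, g)`. -/
def IsLaplaceEigenvalue [MeasurableSpace M] (g : SmoothMetric n M) (lam : ℝ) : Prop :=
  ∃ w : M → ℝ, MemLp w 2 (vol g) ∧ ¬ (w =ᵐ[vol g] 0) ∧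
    ∃ f : ℕ → M → ℝ, ApproximatesSobolev g w f ∧
      ∀ φ : M → ℝ, IsSmooth (n := n) φ →
        Tendsto (fun j ↦ dirichletForm g (f j) φ) atTop
          (𝓝 (lam * ∫ p, w p * φ p ∂(vol g)))

/-- The positive eigenvalues of (minus) the Laplacian of `g`. -/
def positiveEigenvalues [MeasurableSpace M] (g : SmoothMetric n M) : Set ℝ :=
  {lam : ℝ | 0 < lam ∧ IsLaplaceEigenvalue g lam}

/-- The first eigenvalue `λ_1(Δ_g)`: the smallest positive eigenvalue. -/
def firstEigenvalue [MeasurableSpace M] (g : SmoothMetric n M) : ℝ :=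
  sInf (positiveEigenvalues g)

end ConformalPinching

end

/-!
The first eigenvalue is bounded through its variational characterization: if a smooth function is
`1` on a set of volume at least `c` and `0` on another such set, then `λ₁ * c / 2` is at most its
Dirichlet energy (`firstEigenvalue_mul_le`). By hypothesis, for suitable `R₁` and all `R₂ > R₁`
large, both the ball of radius `R₁ r_k` around `x_k` and the complement of the ball of radius
`R₂ r_k` keep a volume at least `c > 0` for the metric `g_k`, so it suffices to find cutoff
functions between these balls whose `g_k`-energy is small.

In dimension four, `|df|² dV` for `g_k = u² g₀` is `u² |df|₀² dV₀`, and
`u² |df|₀² ≤ δ⁻¹ u⁴ + δ |df|₀⁴` with `u⁴ dV₀ = dV`. For a bump at scale `s`, equal to `1` on the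
coordinate ball of radius `s` and `0` outside the one of radius `2 s`, the integral of `|df|₀⁴` is
bounded independently of `s`. So its energy is at most `δ⁻¹` times the `g_k`-volume of the dyadic
annulus that carries its gradient, plus `δ` times a constant
(`IsCoordinateBall.integral_gradInner_chartBump_le`). Among `N` disjoint dyadic annuli, one has
`g_k`-volume at most `1 / N`, since the total volume is `1`. This gives
`λ₁ * c / 2 ≤ δ⁻¹ / N + δ K` as soon as there is room for `N` annuli
(`IsCoordinateBall.firstEigenvalue_mul_le`), and there is room because `R₂` is arbitrary and
`r_k → 0`. Geodesic balls are compared with coordinate balls by `mem_geodesicBall_of_dist_lt` and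
`IsCoordinateBall.mem_of_mem_geodesicBall`; all constants depend on a coordinate ball of the fixed
metric `g₀` only, and finitely many coordinate balls cover `M`.

The variational characterization, and with it the existence of a smallest positive eigenvalue, is
proved for abstract forms on a space of test functions mapped to a Hilbert space
(`IsCompactForm`). A minimizing sequence for the Rayleigh quotient has a subsequence that converges
in the Hilbert space by the Rellich property, and the parallelogram identity makes it Cauchy in the
form norm, so that its limit is an eigenvector. The Rellich property of the Dirichlet form is used
as an Ehrling inequality `‖f‖² ≤ ε D(f, f) + C ∑ ⟪e, f⟫²` with finitely many `e` (`exists_ehrling`):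
coordinate balls are cut into small convex pieces, and the Poincaré inequality on each of them
(`IsCoordinateBall.poincare`) leaves only the mean values over the pieces.
-/

noncomputable section

namespace ConformalPinching

/-! ### The first eigenvalue of an abstract Dirichlet form -/

section Abstract

open scoped InnerProductSpace

variable {V : Type*} [AddCommGroup V] [Module ℝ V]
  {H : Type*} [NormedAddCommGroup H] [InnerProductSpace ℝ H]

/-- A form `D` with compact resolvent whose kernel consists of the constants: `V` is the space of test
functions, `ι` its map to the Hilbert space `H`, `D` a positive semidefinite form on `V` and `one`
the constant function. The field `compact` is the Rellich property in the form of an Ehrling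
inequality with finitely many linear functionals, and `connected` says that limits of sequences
of vanishing energy are constant. -/
structure IsCompactForm (ι : V →ₗ[ℝ] H) (D : V →ₗ[ℝ] V →ₗ[ℝ] ℝ) (one : V) : Prop where
  symm : ∀ f h, D f h = D h f
  nonneg : ∀ f, 0 ≤ D f f
  one_left : ∀ f, D one f = 0
  compact : ∀ ε > 0, ∃ (C : ℝ) (s : Finset H), 0 ≤ C ∧
    ∀ f, ‖ι f‖ ^ 2 ≤ ε * D f f + C * ∑ e ∈ s, ⟪e, ι f⟫_ℝ ^ 2
  connected : ∀ (f : ℕ → V) (w : H), Tendsto (fun j ↦ ι (f j)) atTop (𝓝 w) →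
    Tendsto (fun j ↦ D (f j) (f j)) atTop (𝓝 0) → ∃ c : ℝ, w = c • ι one
  one_ne_zero : ι one ≠ 0
  exists_nonconst : ∃ f, ⟪ι one, ι f⟫_ℝ = 0 ∧ ι f ≠ 0

/-- The infimum of the energies of the normalized test functions orthogonal to the constants. -/
def rayleighInf (ι : V →ₗ[ℝ] H) (D : V →ₗ[ℝ] V →ₗ[ℝ] ℝ) (one : V) : ℝ :=
  sInf {t | ∃ f, ⟪ι one, ι f⟫_ℝ = 0 ∧ ‖ι f‖ = 1 ∧ t = D f f}

/-- `lam` is an eigenvalue of `D` with eigenvector `w`, a limit in form norm of the sequence `f` of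
test functions. -/
structure IsFormEigenvector (ι : V →ₗ[ℝ] H) (D : V →ₗ[ℝ] V →ₗ[ℝ] ℝ) (lam : ℝ) (w : H)
    (f : ℕ → V) : Prop where
  ne_zero : w ≠ 0
  tendsto : Tendsto (fun j ↦ ι (f j)) atTop (𝓝 w)
  cauchy : Tendsto (fun ij : ℕ × ℕ ↦ D (f ij.1 - f ij.2) (f ij.1 - f ij.2)) atTop (𝓝 0)
  weak : ∀ φ, Tendsto (fun j ↦ D (f j) φ) atTop (𝓝 (lam * ⟪w, ι φ⟫_ℝ))

namespace IsCompactForm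

variable {ι : V →ₗ[ℝ] H} {D : V →ₗ[ℝ] V →ₗ[ℝ] ℝ} {one : V}

theorem cauchy_schwarz (h : IsCompactForm ι D one) (f k : V) :
    D f k ^ 2 ≤ D f f * D k k := by
  have key : ∀ t : ℝ, 0 ≤ D k k * (t * t) + (2 * D f k) * t + D f f := fun t ↦ by
    have := h.nonneg (f + t • k)
    simp only [map_add, map_smul, LinearMap.add_apply, LinearMap.smul_apply, smul_eq_mul,
      h.symm k f] at this
    linarith
  have := discrim_le_zero key
  unfold discrim at this
  nlinarith

theorem rayleighInf_le (h : IsCompactForm ι D one) (f : V) (hf : ⟪ι one, ι f⟫_ℝ = 0) :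
    rayleighInf ι D one * ‖ι f‖ ^ 2 ≤ D f f := by
  rcases eq_or_ne (ι f) 0 with h0 | h0
  · simp [h0, h.nonneg f]
  have hn : 0 < ‖ι f‖ := norm_pos_iff.2 h0
  have : rayleighInf ι D one ≤ ‖ι f‖⁻¹ * (‖ι f‖⁻¹ * D f f) := by
    refine csInf_le ⟨0, ?_⟩ ⟨‖ι f‖⁻¹ • f, ?_, ?_, ?_⟩
    · rintro _ ⟨k, -, -, rfl⟩
      exact h.nonneg k
    · simp [inner_smul_right, hf]
    · simp [norm_smul, hn.ne']
    · simp
  calc rayleighInf ι D one * ‖ι f‖ ^ 2 ≤ (‖ι f‖⁻¹ * (‖ι f‖⁻¹ * D f f)) * ‖ι f‖ ^ 2 := by gcongr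
    _ = D f f := by field_simp

theorem rayleighInf_nonneg (h : IsCompactForm ι D one) : 0 ≤ rayleighInf ι D one :=
  Real.sInf_nonneg (by rintro _ ⟨k, -, -, rfl⟩; exact h.nonneg k)

/-- The parallelogram identity. -/
theorem D_sub (f k : V) :
    D (f - k) (f - k) = 2 * D f f + 2 * D k k - D (f + k) (f + k) := by
  simp only [map_add, map_sub, LinearMap.add_apply, LinearMap.sub_apply]
  ring

/-- Sets of test functions bounded in form norm are totally bounded in `H`. -/
theorem totallyBounded (h : IsCompactForm ι D one) (C : ℝ) :
    TotallyBounded (ι '' {f | ‖ι f‖ ≤ C ∧ D f f ≤ C}) := by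
  rw [Metric.totallyBounded_iff]
  intro ε hε
  set S := {f | ‖ι f‖ ≤ C ∧ D f f ≤ C} with hS
  obtain ⟨δ, hδ, hδC⟩ : ∃ δ > 0, δ * (4 * C) < ε ^ 2 / 2 := by
    have h1 : Tendsto (fun δ : ℝ ↦ δ * (4 * C)) (𝓝[>] 0) (𝓝 0) := by
      have : Tendsto (fun δ : ℝ ↦ δ * (4 * C)) (𝓝 0) (𝓝 (0 * (4 * C))) :=
        tendsto_id.mul_const _
      rw [zero_mul] at this
      exact this.mono_left nhdsWithin_le_nhds
    have h2 := h1.eventually (gt_mem_nhds (show (0 : ℝ) < ε ^ 2 / 2 by positivity))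
    obtain ⟨δ, h3, h4⟩ := (h2.and self_mem_nhdsWithin).exists
    exact ⟨δ, h4, h3⟩
  obtain ⟨B, s, hB, hs⟩ := h.compact δ hδ
  let T : V → (s → ℝ) := fun f e ↦ ⟪(e : H), ι f⟫_ℝ
  obtain ⟨η, hη, hηs⟩ : ∃ η > 0, B * (s.card * η ^ 2) < ε ^ 2 / 2 := by
    have h1 : Tendsto (fun η : ℝ ↦ B * (s.card * η ^ 2)) (𝓝[>] 0) (𝓝 0) := by
      have : Tendsto (fun η : ℝ ↦ B * (s.card * η ^ 2)) (𝓝 0) (𝓝 (B * (s.card * 0 ^ 2))) :=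
        ((tendsto_id.pow 2).const_mul _).const_mul _
      simp only [ne_eq, OfNat.ofNat_ne_zero, not_false_eq_true, zero_pow, mul_zero] at this
      exact this.mono_left nhdsWithin_le_nhds
    have h2 := h1.eventually (gt_mem_nhds (show (0 : ℝ) < ε ^ 2 / 2 by positivity))
    obtain ⟨δ, h3, h4⟩ := (h2.and self_mem_nhdsWithin).exists
    exact ⟨δ, h4, h3⟩
  have hTb : Bornology.IsBounded (T '' S) := by
    rw [Bornology.forall_isBounded_image_eval_iff.symm]
    intro e
    rw [isBounded_iff_forall_norm_le]
    refine ⟨‖(e : H)‖ * C, ?_⟩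
    rintro _ ⟨_, ⟨f, hf, rfl⟩, rfl⟩
    exact (norm_inner_le_norm (𝕜 := ℝ) _ _).trans (by gcongr; exact hf.1)
  have hTt : TotallyBounded (T '' S) :=
    hTb.isCompact_closure.totallyBounded.subset subset_closure
  obtain ⟨t, htS, htf, ht⟩ := Metric.finite_approx_of_totallyBounded hTt η hη
  have htS' : ∀ y ∈ t, ∃ f ∈ S, T f = y := fun y hy ↦ htS hy
  choose! k hkS hk using htS'
  refine ⟨(ι ∘ k) '' t, htf.image _, ?_⟩
  rintro _ ⟨f, hf, rfl⟩
  obtain ⟨y, hy, hfy⟩ := Set.mem_iUnion₂.1 (ht ⟨f, hf, rfl⟩)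
  refine Set.mem_iUnion₂.2 ⟨ι (k y), ⟨y, hy, rfl⟩, ?_⟩
  rw [Metric.mem_ball, dist_eq_norm, ← map_sub]
  have hD : D (f - k y) (f - k y) ≤ 4 * C := by
    have := D_sub (D := D) f (k y)
    have h1 := h.nonneg (f + k y)
    have h2 := hf.2
    have h3 := (hkS y hy).2
    linarith
  have hsum : ∑ e ∈ s, ⟪e, ι (f - k y)⟫_ℝ ^ 2 ≤ s.card * η ^ 2 := by
    rw [← nsmul_eq_mul]
    refine Finset.sum_le_card_nsmul _ _ _ fun e he ↦ ?_
    have h1 : dist (T f ⟨e, he⟩) (T (k y) ⟨e, he⟩) < η := by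
      refine (dist_le_pi_dist _ _ _).trans_lt ?_
      rw [hk y hy]
      exact hfy
    rw [Real.dist_eq] at h1
    have h2 : ⟪e, ι (f - k y)⟫_ℝ = T f ⟨e, he⟩ - T (k y) ⟨e, he⟩ := by
      simp [T, inner_sub_right]
    rw [h2, ← sq_abs]
    gcongr
  have h4 := hs (f - k y)
  have h5 : δ * D (f - k y) (f - k y) ≤ δ * (4 * C) := by gcongr
  have h6 := mul_le_mul_of_nonneg_left hsum hB
  exact lt_of_pow_lt_pow_left₀ 2 hε.le (by linarith)

/-- The infimum of the Rayleigh quotient is a lower bound for the positive eigenvalues: eigenvectors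
with a positive eigenvalue are orthogonal to the constants. -/
theorem rayleighInf_le_of_eigenvector (h : IsCompactForm ι D one) {lam : ℝ} (hlam : 0 < lam)
    {w : H} {f : ℕ → V} (hw : IsFormEigenvector ι D lam w f) : rayleighInf ι D one ≤ lam := by
  set m := rayleighInf ι D one with hm
  have horth : ⟪ι one, w⟫_ℝ = 0 := by
    have h1 := tendsto_nhds_unique (hw.weak one) (by
      simp only [h.symm (f _) one, h.one_left]
      exact tendsto_const_nhds)
    rw [mul_eq_zero] at h1
    rw [real_inner_comm]
    exact h1.resolve_left hlam.ne'
  have hn : ‖ι one‖ ≠ 0 := norm_ne_zero_iff.2 h.one_ne_zero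
  let c : ℕ → ℝ := fun j ↦ ⟪ι one, ι (f j)⟫_ℝ / ‖ι one‖ ^ 2
  have hc : Tendsto c atTop (𝓝 0) := by
    have : Tendsto c atTop (𝓝 (⟪ι one, w⟫_ℝ / ‖ι one‖ ^ 2)) :=
      (tendsto_const_nhds.inner hw.tendsto).div_const _
    rwa [horth, zero_div] at this
  have h1 : ∀ j, m * ‖ι (f j) - c j • ι one‖ ^ 2 ≤ D (f j) (f j) := fun j ↦ by
    have := h.rayleighInf_le (f j - c j • one) (by
      simp only [map_sub, map_smul, inner_sub_right, inner_smul_right,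
        real_inner_self_eq_norm_sq, c]
      field_simp
      ring)
    simpa [h.one_left, h.symm (f _) one] using this
  have h2 : Tendsto (fun j ↦ m * ‖ι (f j) - c j • ι one‖ ^ 2) atTop
      (𝓝 (m * ‖w - (0 : ℝ) • ι one‖ ^ 2)) :=
    ((hw.tendsto.sub (hc.smul_const _)).norm.pow 2).const_mul _
  -- Since the energies of the differences tend to zero, the energy of `f i` exceeds the limit
  -- `lam * ⟪w, ι (f i)⟫` of `D (f j) (f i)` by at most `η * (1 + D (f i) (f i))`.
  have h3 : m * ‖w‖ ^ 2 ≤ lam * ‖w‖ ^ 2 := by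
    rw [zero_smul, sub_zero] at h2
    have hev : ∀ η > 0, ∀ᶠ i in atTop, (1 - η) * D (f i) (f i) ≤ lam * ⟪w, ι (f i)⟫_ℝ + η := by
      intro η hη
      obtain ⟨⟨N, N'⟩, hN⟩ := eventually_atTop.1
        (hw.cauchy.eventually (gt_mem_nhds (show (0 : ℝ) < 4 * η ^ 2 by positivity)))
      filter_upwards [eventually_ge_atTop N'] with i hi
      have : (1 - η) * D (f i) (f i) - η ≤ lam * ⟪w, ι (f i)⟫_ℝ := by
        refine ge_of_tendsto (hw.weak (f i)) ?_
        filter_upwards [eventually_ge_atTop N] with j hj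
        have hji := hN (j, i) ⟨hj, hi⟩
        have cs := h.cauchy_schwarz (f j - f i) (f i)
        have e1 : D (f j) (f i) = D (f i) (f i) + D (f j - f i) (f i) := by simp
        have hp := h.nonneg (f i)
        simp only at hji
        have : (D (f j - f i) (f i)) ^ 2 ≤ (η * (1 + D (f i) (f i))) ^ 2 := by
          have : D (f j - f i) (f j - f i) * D (f i) (f i) ≤ 4 * η ^ 2 * D (f i) (f i) := by gcongr
          nlinarith [mul_nonneg (sq_nonneg η) (sq_nonneg (1 - D (f i) (f i)))]
        have := abs_le_of_sq_le_sq' this (by positivity)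
        rw [e1]
        linarith [this.1]
      linarith
    have hη : ∀ η : ℝ, 0 < η → η < 1 → (1 - η) * (m * ‖w‖ ^ 2) ≤ lam * ‖w‖ ^ 2 + η := by
      intro η hη hη1
      have l1 : Tendsto (fun i ↦ lam * ⟪w, ι (f i)⟫_ℝ + η) atTop (𝓝 (lam * ⟪w, w⟫_ℝ + η)) :=
        ((tendsto_const_nhds.inner hw.tendsto).const_mul _).add_const _
      rw [real_inner_self_eq_norm_sq] at l1
      refine le_of_tendsto_of_tendsto (h2.const_mul (1 - η)) l1 ?_
      filter_upwards [hev η hη] with i hi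
      refine le_trans ?_ hi
      have : 0 ≤ 1 - η := by linarith
      gcongr
      exact h1 i
    have l2 : Tendsto (fun η : ℝ ↦ (1 - η) * (m * ‖w‖ ^ 2)) (𝓝[>] 0)
        (𝓝 ((1 - 0) * (m * ‖w‖ ^ 2))) :=
      ((tendsto_const_nhds.sub tendsto_id).mul_const _).mono_left nhdsWithin_le_nhds
    have l3 : Tendsto (fun η : ℝ ↦ lam * ‖w‖ ^ 2 + η) (𝓝[>] 0) (𝓝 (lam * ‖w‖ ^ 2 + 0)) :=
      (tendsto_const_nhds.add tendsto_id).mono_left nhdsWithin_le_nhds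
    have := le_of_tendsto_of_tendsto l2 l3 (by
      filter_upwards [self_mem_nhdsWithin,
        nhdsWithin_le_nhds (gt_mem_nhds (zero_lt_one (α := ℝ)))] with η h4 h5
      exact hη η h4 h5)
    simpa using this
  have hwn : 0 < ‖w‖ ^ 2 := by have := norm_pos_iff.2 hw.ne_zero; positivity
  exact le_of_mul_le_mul_right h3 hwn

variable [CompleteSpace H]

theorem exists_subseq (h : IsCompactForm ι D one) (f : ℕ → V) (C : ℝ)
    (hf : ∀ j, ‖ι (f j)‖ ≤ C ∧ D (f j) (f j) ≤ C) :
    ∃ (w : H) (σ : ℕ → ℕ), StrictMono σ ∧ Tendsto (fun j ↦ ι (f (σ j))) atTop (𝓝 w) := by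
  have hK := (h.totallyBounded C).closure.isCompact_of_isClosed isClosed_closure
  obtain ⟨w, -, σ, hσ, hw⟩ := hK.tendsto_subseq (x := fun j ↦ ι (f j))
    fun j ↦ subset_closure ⟨f j, hf j, rfl⟩
  exact ⟨w, σ, hσ, hw⟩

/-- There is a minimizing sequence for the Rayleigh quotient that converges in `H`. -/
theorem exists_minimizing (h : IsCompactForm ι D one) :
    ∃ (w : H) (f : ℕ → V), ‖w‖ = 1 ∧ ⟪ι one, w⟫_ℝ = 0 ∧ (∀ j, ⟪ι one, ι (f j)⟫_ℝ = 0) ∧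
      (∀ j, ‖ι (f j)‖ = 1) ∧
      Tendsto (fun j ↦ ι (f j)) atTop (𝓝 w) ∧
      Tendsto (fun j ↦ D (f j) (f j)) atTop (𝓝 (rayleighInf ι D one)) := by
  have hne : {t | ∃ f, ⟪ι one, ι f⟫_ℝ = 0 ∧ ‖ι f‖ = 1 ∧ t = D f f}.Nonempty := by
    obtain ⟨f, h1, h2⟩ := h.exists_nonconst
    exact ⟨_, ‖ι f‖⁻¹ • f, by simp [inner_smul_right, h1],
      by simp [norm_smul, h2], rfl⟩
  have hbdd : BddBelow {t | ∃ f, ⟪ι one, ι f⟫_ℝ = 0 ∧ ‖ι f‖ = 1 ∧ t = D f f} :=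
    ⟨0, by rintro _ ⟨k, -, -, rfl⟩; exact h.nonneg k⟩
  obtain ⟨t, -, htt, ht⟩ := exists_seq_tendsto_sInf hne hbdd
  choose f hf1 hf2 hf3 using ht
  obtain ⟨C, hC⟩ := htt.bddAbove_range
  obtain ⟨w, σ, hσ, hw⟩ := h.exists_subseq f (max 1 C) fun j ↦
    ⟨(hf2 j).le.trans (le_max_left _ _), by
      rw [← hf3]
      exact (hC ⟨j, rfl⟩).trans (le_max_right _ _)⟩
  refine ⟨w, f ∘ σ, ?_, ?_, fun j ↦ hf1 _, fun j ↦ hf2 _, hw, ?_⟩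
  · refine tendsto_nhds_unique hw.norm ?_
    simp [hf2]
  · refine tendsto_nhds_unique (tendsto_const_nhds.inner hw) ?_
    simp [hf1]
  · have := htt.comp hσ.tendsto_atTop
    refine this.congr fun j ↦ ?_
    simp [hf3]

theorem rayleighInf_pos (h : IsCompactForm ι D one) : 0 < rayleighInf ι D one := by
  refine lt_of_le_of_ne h.rayleighInf_nonneg fun h0 ↦ ?_
  obtain ⟨w, f, h1, h2, -, -, h5, h6⟩ := h.exists_minimizing
  rw [← h0] at h6
  obtain ⟨c, rfl⟩ := h.connected f w h5 h6
  rw [inner_smul_right, real_inner_self_eq_norm_sq, mul_eq_zero] at h2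
  rcases h2 with rfl | h2
  · simp at h1
  · exact h.one_ne_zero (by simpa using h2)

/-- If a linear function of `t` plus a quadratic one is nonnegative, then the linear part is zero. -/
theorem eq_zero_of_forall_nonneg {a b : ℝ} (h : ∀ t : ℝ, 0 ≤ a * t + b * t ^ 2) : a = 0 := by
  have hb : ∀ t : ℝ, 0 ≤ b * (t * t) + a * t + 0 := fun t ↦ by linarith [h t]
  have := discrim_le_zero hb
  unfold discrim at this
  nlinarith [sq_nonneg a]

/-- The infimum of the Rayleigh quotient is an eigenvalue. A minimizing sequence is Cauchy in the
form norm by the parallelogram identity, and the first variation at its limit vanishes. -/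
theorem exists_eigenvector (h : IsCompactForm ι D one) :
    ∃ w f, IsFormEigenvector ι D (rayleighInf ι D one) w f := by
  obtain ⟨w, f, h1, h2, h3, h4, h5, h6⟩ := h.exists_minimizing
  set m := rayleighInf ι D one with hm
  have hcauchy : Tendsto (fun ij : ℕ × ℕ ↦ D (f ij.1 - f ij.2) (f ij.1 - f ij.2)) atTop (𝓝 0) := by
    rw [← prod_atTop_atTop_eq]
    have t1 : Tendsto (fun ij : ℕ × ℕ ↦ D (f ij.1) (f ij.1)) (atTop ×ˢ atTop) (𝓝 m) :=
      h6.comp tendsto_fst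
    have t2 : Tendsto (fun ij : ℕ × ℕ ↦ D (f ij.2) (f ij.2)) (atTop ×ˢ atTop) (𝓝 m) :=
      h6.comp tendsto_snd
    have t3 : Tendsto (fun ij : ℕ × ℕ ↦ ‖ι (f ij.1) + ι (f ij.2)‖ ^ 2) (atTop ×ˢ atTop)
        (𝓝 (‖w + w‖ ^ 2)) :=
      ((h5.comp tendsto_fst).add (h5.comp tendsto_snd)).norm.pow 2
    have t4 := ((t1.const_mul 2).add (t2.const_mul 2)).sub (t3.const_mul m)
    have e4 : 2 * m + 2 * m - m * ‖w + w‖ ^ 2 = 0 := by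
      rw [← two_smul ℝ w, norm_smul, h1]
      norm_num
      ring
    rw [e4] at t4
    refine squeeze_zero (fun _ ↦ h.nonneg _) (fun ij ↦ ?_) t4
    rw [D_sub, ← map_add]
    have := h.rayleighInf_le (f ij.1 + f ij.2) (by simp [inner_add_right, h3])
    linarith
  have hlim : ∀ φ, ∃ l, Tendsto (fun j ↦ D (f j) φ) atTop (𝓝 l) := fun φ ↦ by
    apply cauchySeq_tendsto_of_complete
    rw [Metric.cauchySeq_iff']
    intro ε hε
    have := hcauchy.mul_const (D φ φ)
    rw [zero_mul] at this
    obtain ⟨⟨N, N'⟩, hN⟩ := eventually_atTop.1 (this.eventually (gt_mem_nhds (pow_pos hε 2)))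
    refine ⟨max N N', fun k hk ↦ ?_⟩
    have h7 := hN (k, max N N') ⟨(le_max_left _ _).trans hk, le_max_right _ _⟩
    rw [Real.dist_eq]
    refine lt_of_pow_lt_pow_left₀ 2 hε.le ?_
    rw [sq_abs]
    refine lt_of_le_of_lt ?_ h7
    have := h.cauchy_schwarz (f k - f (max N N')) φ
    simpa only [map_sub, LinearMap.sub_apply] using this
  -- The Rayleigh inequality for `f j + t • φ`, in the limit, is the first variation.
  have horth : ∀ φ, ⟪ι one, ι φ⟫_ℝ = 0 →
      Tendsto (fun j ↦ D (f j) φ) atTop (𝓝 (m * ⟪w, ι φ⟫_ℝ)) := fun φ hφ ↦ by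
    obtain ⟨l, hl⟩ := hlim φ
    suffices 2 * l - 2 * m * ⟪w, ι φ⟫_ℝ = 0 by
      rwa [show m * ⟪w, ι φ⟫_ℝ = l by linarith]
    refine eq_zero_of_forall_nonneg (b := D φ φ - m * ‖ι φ‖ ^ 2) fun t ↦ ?_
    have a1 : Tendsto (fun j ↦ D (f j) (f j) + 2 * t * D (f j) φ + t ^ 2 * D φ φ
        - m * (‖ι (f j)‖ ^ 2 + 2 * t * ⟪ι (f j), ι φ⟫_ℝ + t ^ 2 * ‖ι φ‖ ^ 2)) atTop
        (𝓝 (m + 2 * t * l + t ^ 2 * D φ φ -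
          m * (‖w‖ ^ 2 + 2 * t * ⟪w, ι φ⟫_ℝ + t ^ 2 * ‖ι φ‖ ^ 2))) :=
      ((h6.add (hl.const_mul _)).add_const _).sub
        ((((h5.norm.pow 2).add ((h5.inner tendsto_const_nhds).const_mul _)).add_const _).const_mul _)
    have a2 := ge_of_tendsto' a1 (b := 0) fun j ↦ ?_
    · rw [h1] at a2
      linarith
    · have := h.rayleighInf_le (f j + t • φ) (by simp [inner_add_right, inner_smul_right, h3, hφ])
      have e1 : ‖ι (f j + t • φ)‖ ^ 2 =
          ‖ι (f j)‖ ^ 2 + 2 * t * ⟪ι (f j), ι φ⟫_ℝ + t ^ 2 * ‖ι φ‖ ^ 2 := by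
        rw [map_add, map_smul, norm_add_sq_real, inner_smul_right, norm_smul, mul_pow,
          Real.norm_eq_abs, sq_abs]
        ring
      rw [e1] at this
      simp only [map_add, map_smul, LinearMap.add_apply, LinearMap.smul_apply, smul_eq_mul,
        h.symm φ (f j)] at this
      linarith
  refine ⟨w, f, ⟨by rintro rfl; simp at h1, h5, hcauchy, fun φ ↦ ?_⟩⟩
  set c := ⟪ι one, ι φ⟫_ℝ / ‖ι one‖ ^ 2 with hc
  have hn : ‖ι one‖ ≠ 0 := norm_ne_zero_iff.2 h.one_ne_zero
  have := horth (φ - c • one) (by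
    rw [map_sub, map_smul, inner_sub_right, inner_smul_right, real_inner_self_eq_norm_sq, hc]
    field_simp
    ring)
  rw [real_inner_comm] at h2
  simpa only [map_sub, map_smul, inner_sub_right, inner_smul_right, h2,
    h.symm (f _) one, h.one_left, smul_zero, mul_zero, sub_zero] using this

end IsCompactForm

end Abstract

/-! ### The metric in a chart -/

section ChartCalculus

variable {n : ℕ} {M : Type*} [TopologicalSpace M] [ChartedSpace (EuclideanSpace ℝ (Fin n)) M]
  [IsManifold (𝓡 n) ∞ M]

local notation "E" => EuclideanSpace ℝ (Fin n)
local notation "φ" => extChartAt (𝓡 n)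

/-- The scalar product of `g` at `m`, as a form on the model space. -/
def metricForm (g : SmoothMetric n M) (m : M) : E →L[ℝ] E →L[ℝ] ℝ := g.inner m

variable (n) in
/-- The derivative of the inverse of the chart around `p`, as an endomorphism of the model
space. -/
def chartDeriv (p : M) (y : EuclideanSpace ℝ (Fin n)) :
    EuclideanSpace ℝ (Fin n) →L[ℝ] EuclideanSpace ℝ (Fin n) :=
  mfderiv (𝓡 n) (𝓡 n) (extChartAt (𝓡 n) p).symm y

/-- The scalar product of `g` pulled back to the target of the chart around `p`. -/
def coordForm (g : SmoothMetric n M) (p : M) (y a b : E) : ℝ :=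
  metricForm g ((φ p).symm y) (chartDeriv n p y a) (chartDeriv n p y b)

theorem continuousOn_coordForm (g : SmoothMetric n M) (p : M) (a b : E) :
    ContinuousOn (fun y ↦ coordForm g p y a b) (φ p).target := by
  have hsec : ∀ a : E, ContMDiffOn (𝓡 n) (𝓡 n).tangent 0
      (fun y ↦ (⟨(φ p).symm y, chartDeriv n p y a⟩ : TangentBundle (𝓡 n) M)) (φ p).target := by
    intro a
    have h1 : ContMDiffOn (𝓡 n) (𝓡 n) 1 (φ p).symm (φ p).target :=
      (contMDiffOn_extChartAt_symm p).of_le (by norm_cast)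
    have h2 := h1.contMDiffOn_tangentMapWithin (m := 0) (by norm_num)
      (isOpen_extChartAt_target p).uniqueMDiffOn
    have h3 : ContMDiffOn (𝓡 n) (𝓡 n).tangent 0
        (fun y : E ↦ (⟨y, a⟩ : TangentBundle (𝓡 n) E)) (φ p).target :=
      (contMDiffOn_vectorSpace_iff_contDiffOn (V := fun _ : E ↦ a)).2 contDiffOn_const
    have h4 := h2.comp h3 (fun y hy ↦ hy)
    refine h4.congr fun y hy ↦ ?_
    simp only [Function.comp, tangentMapWithin]
    rw [mfderivWithin_of_isOpen (isOpen_extChartAt_target p) hy]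
    rfl
  let : RiemannianBundle (fun q : M ↦ TangentSpace (𝓡 n) q) := ⟨g.toRiemannianMetric⟩
  have := ContMDiffOn.inner_bundle (IB := 𝓡 n) (hsec a) (hsec b)
  exact this.continuousOn

theorem mdifferentiableAt_symm {p : M} {y : E} (hy : y ∈ (φ p).target) :
    MDifferentiableAt (𝓡 n) (𝓡 n) (φ p).symm y :=
  (mdifferentiableOn_extChartAt_symm y hy).mdifferentiableAt
    ((isOpen_extChartAt_target p).mem_nhds hy)

theorem chartDeriv_bijective {p : M} {y : E} (hy : y ∈ (φ p).target) :
    Function.Bijective (chartDeriv n p y) := by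
  have h1 := isInvertible_mfderivWithin_extChartAt_symm (I := 𝓡 n) hy
  rw [ModelWithCorners.range_eq_univ, mfderivWithin_univ] at h1
  exact h1.bijective

theorem differential_chartDeriv {p : M} {y : E} (hy : y ∈ (φ p).target) {f : M → ℝ}
    (hf : MDifferentiableAt (𝓡 n) 𝓘(ℝ, ℝ) f ((φ p).symm y)) (a : E) :
    differential (n := n) f ((φ p).symm y) (chartDeriv n p y a) =
      fderiv ℝ (f ∘ (φ p).symm) y a := by
  have h1 := mfderiv_comp y hf (mdifferentiableAt_symm hy)
  rw [mfderiv_eq_fderiv] at h1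
  rw [h1]
  rfl

theorem gramMatrix_apply (g : SmoothMetric n M) (p : M) (y : E) (i j : Fin n) :
    gramMatrix g p y i j =
      coordForm g p y (EuclideanSpace.single i 1) (EuclideanSpace.single j 1) := rfl

theorem coordForm_eq (g : SmoothMetric n M) (p : M) (y a b : E) :
    coordForm g p y a b = ∑ i, ∑ j, a i * b j * gramMatrix g p y i j := by
  have hs : ∀ a : E, a = ∑ i, a i • EuclideanSpace.single i (1 : ℝ) := fun a ↦ by
    ext j
    simp [Finset.sum_apply, Pi.single_apply]
  conv_lhs => rw [hs a, hs b]
  simp only [coordForm, map_sum, map_smul, sum_apply,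
    smul_apply, smul_eq_mul, Finset.mul_sum, gramMatrix_apply]
  rw [Finset.sum_comm]
  exact Finset.sum_congr rfl fun i _ ↦ Finset.sum_congr rfl fun j _ ↦ by ring

theorem coordForm_eq_dotProduct (g : SmoothMetric n M) (p : M) (y a b : E) :
    coordForm g p y a b = a.ofLp ⬝ᵥ (gramMatrix g p y).mulVec b.ofLp := by
  rw [coordForm_eq]
  simp only [dotProduct, Matrix.mulVec, Finset.mul_sum]
  exact Finset.sum_congr rfl fun i _ ↦ Finset.sum_congr rfl fun j _ ↦ by ring

theorem coordForm_symm (g : SmoothMetric n M) (p : M) (y a b : E) :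
    coordForm g p y a b = coordForm g p y b a := g.symm _ _ _

theorem coordForm_pos (g : SmoothMetric n M) {p : M} {y : E} (hy : y ∈ (φ p).target) {a : E}
    (ha : a ≠ 0) : 0 < coordForm g p y a a := by
  refine g.pos _ _ fun h0 ↦ ha ((chartDeriv_bijective hy).1 ?_)
  rw [map_zero]
  exact h0

theorem continuousOn_gramMatrix (g : SmoothMetric n M) (p : M) :
    ContinuousOn (gramMatrix g p) (φ p).target :=
  continuousOn_pi.2 fun _ ↦ continuousOn_pi.2 fun _ ↦ continuousOn_coordForm g p _ _

theorem gramMatrix_posDef (g : SmoothMetric n M) {p : M} {y : E} (hy : y ∈ (φ p).target) :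
    (gramMatrix g p y).PosDef := by
  refine Matrix.PosDef.of_dotProduct_mulVec_pos ?_ fun v hv ↦ ?_
  · ext i j
    exact coordForm_symm g p y _ _
  · have := coordForm_pos g hy (a := WithLp.toLp 2 v) (by simpa using hv)
    rw [coordForm_eq_dotProduct] at this
    simpa using this

theorem continuousOn_sqrt_det (g : SmoothMetric n M) (p : M) :
    ContinuousOn (fun y ↦ √(gramMatrix g p y).det) (φ p).target := by
  have : Continuous fun A : Matrix (Fin n) (Fin n) ℝ ↦ A.det := continuous_id.matrix_det
  exact (this.comp_continuousOn (continuousOn_gramMatrix g p)).sqrt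

theorem sqrt_det_pos (g : SmoothMetric n M) {p : M} {y : E} (hy : y ∈ (φ p).target) :
    0 < √(gramMatrix g p y).det :=
  Real.sqrt_pos.2 (gramMatrix_posDef g hy).det_pos

/-- Around each point there are coordinate balls on which the metric is comparable to the
Euclidean one. -/
theorem exists_coordForm_bounds (g : SmoothMetric n M) (p : M) :
    ∃ r > 0, ∃ lam > 0, ∃ Lam > 0, Metric.closedBall (φ p p) r ⊆ (φ p).target ∧
      ∀ y ∈ Metric.closedBall (φ p p) r, ∀ a : E,
        lam * ‖a‖ ^ 2 ≤ coordForm g p y a a ∧ coordForm g p y a a ≤ Lam * ‖a‖ ^ 2 := by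
  obtain ⟨r, hr, hrt⟩ := Metric.nhds_basis_closedBall.mem_iff.1
    ((isOpen_extChartAt_target p).mem_nhds (mem_extChartAt_target (I := 𝓡 n) p))
  have hc : ContinuousOn (fun z : E × E ↦ coordForm g p z.1 z.2 z.2)
      (Metric.closedBall (φ p p) r ×ˢ Metric.sphere 0 1) := by
    simp only [coordForm_eq]
    refine continuousOn_finsetSum _ fun i _ ↦ continuousOn_finsetSum _ fun j _ ↦ ?_
    refine ContinuousOn.mul (by fun_prop) ?_
    exact (continuousOn_coordForm g p _ _).comp continuousOn_fst fun z hz ↦ hrt hz.1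
  have hK : IsCompact (Metric.closedBall (φ p p) r ×ˢ Metric.sphere (0 : E) 1) :=
    (isCompact_closedBall _ _).prod (isCompact_sphere _ _)
  obtain ⟨lam, hlam, h1⟩ := hK.exists_forall_le' hc (a := 0) fun z hz ↦
    coordForm_pos g (hrt hz.1) (norm_ne_zero_iff.1 (by simp [mem_sphere_zero_iff_norm.1 hz.2]))
  obtain ⟨Lam, h2⟩ := hK.bddAbove_image hc
  refine ⟨r, hr, lam, hlam, max Lam 1, by positivity, hrt, fun y hy a ↦ ?_⟩
  rcases eq_or_ne a 0 with rfl | ha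
  · simp [coordForm]
  have hn : 0 < ‖a‖ := norm_pos_iff.2 ha
  have hz : (y, ‖a‖⁻¹ • a) ∈ Metric.closedBall (φ p p) r ×ˢ Metric.sphere (0 : E) 1 :=
    ⟨hy, by simp [norm_smul, hn.ne']⟩
  have e1 : coordForm g p y a a = coordForm g p y (‖a‖⁻¹ • a) (‖a‖⁻¹ • a) * ‖a‖ ^ 2 := by
    simp only [coordForm, map_smul, smul_apply, smul_eq_mul]
    field_simp
  rw [e1]
  constructor
  · gcongr
    exact h1 _ hz
  · gcongr
    exact (h2 ⟨_, hz, rfl⟩).trans (le_max_left _ _)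

/-! ### Gradients -/

/-- The function `g(∇f, ∇h)`. -/
def gradInner (g : SmoothMetric n M) (f h : M → ℝ) (m : M) : ℝ :=
  g.inner m (riemGrad g f m) (riemGrad g h m)

theorem inner_riemGrad (g : SmoothMetric n M) (f : M → ℝ) (m : M) (w : TangentSpace (𝓡 n) m) :
    g.inner m (riemGrad g f m) w = differential (n := n) f m w :=
  (exists_riemGrad g f m).choose_spec w

theorem gradInner_symm (g : SmoothMetric n M) (f h : M → ℝ) (m : M) :
    gradInner g f h m = gradInner g h f m := g.symm _ _ _

theorem gradInner_self_nonneg (g : SmoothMetric n M) (f : M → ℝ) (m : M) :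
    0 ≤ gradInner g f f m := by
  by_cases h : riemGrad g f m = 0
  · simp [gradInner, h]
  · exact (g.pos _ _ h).le

theorem gradInner_eq (g : SmoothMetric n M) (f h : M → ℝ) (m : M) :
    gradInner g f h m = differential (n := n) f m (riemGrad g h m) := inner_riemGrad g f m _

theorem differential_sq_le (g : SmoothMetric n M) (f : M → ℝ) (m : M)
    (w : TangentSpace (𝓡 n) m) :
    differential (n := n) f m w ^ 2 ≤ gradInner g f f m * g.inner m w w := by
  have key : ∀ t : ℝ, 0 ≤ g.inner m w w * (t * t) + (2 * differential (n := n) f m w) * t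
      + gradInner g f f m := fun t ↦ by
    have h0 : 0 ≤ g.inner m (riemGrad g f m + t • w) (riemGrad g f m + t • w) := by
      by_cases h : riemGrad g f m + t • w = 0
      · rw [h]; simp
      · exact (g.pos _ _ h).le
    have e : g.inner m (riemGrad g f m + t • w) (riemGrad g f m + t • w) =
        g.inner m w w * (t * t) + (2 * differential (n := n) f m w) * t + gradInner g f f m := by
      rw [← inner_riemGrad g f m w, gradInner]
      simp only [map_add, map_smul, add_apply, smul_apply,
        smul_eq_mul, g.symm m w (riemGrad g f m)]
      ring
    rwa [e] at h0
  have := discrim_le_zero key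
  unfold discrim at this
  nlinarith

/-- The gradient in coordinates: `∇f` is the image of a vector dual to the derivative of `f`. -/
theorem exists_coord_grad (g : SmoothMetric n M) {p : M} {y : E} (hy : y ∈ (φ p).target)
    {f : M → ℝ} (hf : MDifferentiableAt (𝓡 n) 𝓘(ℝ, ℝ) f ((φ p).symm y)) :
    ∃ a : E, riemGrad g f ((φ p).symm y) = chartDeriv n p y a ∧
      ∀ b, coordForm g p y a b = fderiv ℝ (f ∘ (φ p).symm) y b := by
  obtain ⟨a, ha⟩ := (chartDeriv_bijective hy).2 (riemGrad g f ((φ p).symm y))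
  refine ⟨a, ha.symm, fun b ↦ ?_⟩
  rw [← differential_chartDeriv hy hf, coordForm, ha]
  exact inner_riemGrad g f _ _

theorem gradInner_le_of_le_coordForm (g : SmoothMetric n M) {p : M} {y : E}
    (hy : y ∈ (φ p).target) {f : M → ℝ}
    (hf : MDifferentiableAt (𝓡 n) 𝓘(ℝ, ℝ) f ((φ p).symm y)) {lam : ℝ} (hlam : 0 < lam)
    (h : ∀ a, lam * ‖a‖ ^ 2 ≤ coordForm g p y a a) :
    gradInner g f f ((φ p).symm y) ≤ lam⁻¹ * ‖fderiv ℝ (f ∘ (φ p).symm) y‖ ^ 2 := by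
  obtain ⟨a, ha, hab⟩ := exists_coord_grad g hy hf
  have e : gradInner g f f ((φ p).symm y) = coordForm g p y a a := by
    rw [gradInner, ha]; rfl
  have h0 := gradInner_self_nonneg g f ((φ p).symm y)
  have h1 := h a
  have h2 := (le_abs_self _).trans ((fderiv ℝ (f ∘ (φ p).symm) y).le_opNorm a)
  rw [e] at h0 ⊢
  rw [← hab a] at h2
  set t := coordForm g p y a a
  set N := ‖fderiv ℝ (f ∘ (φ p).symm) y‖
  have hN : 0 ≤ N := norm_nonneg _
  rw [inv_mul_eq_div, le_div_iff₀ hlam]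
  rcases h0.eq_or_lt with h0 | h0
  · rw [← h0]; simp; positivity
  have h3 : t ^ 2 ≤ (N * ‖a‖) ^ 2 := by gcongr
  have h4 : lam * t ^ 2 ≤ N ^ 2 * t := by nlinarith [sq_nonneg N]
  nlinarith

theorem norm_fderiv_sq_le_of_coordForm_le (g : SmoothMetric n M) {p : M} {y : E}
    (hy : y ∈ (φ p).target) {f : M → ℝ}
    (hf : MDifferentiableAt (𝓡 n) 𝓘(ℝ, ℝ) f ((φ p).symm y)) {Lam : ℝ} (hLam : 0 < Lam)
    (h : ∀ a, coordForm g p y a a ≤ Lam * ‖a‖ ^ 2) :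
    ‖fderiv ℝ (f ∘ (φ p).symm) y‖ ^ 2 ≤ Lam * gradInner g f f ((φ p).symm y) := by
  have h0 := gradInner_self_nonneg g f ((φ p).symm y)
  rw [← Real.le_sqrt (norm_nonneg _) (by positivity)]
  refine ContinuousLinearMap.opNorm_le_bound _ (Real.sqrt_nonneg _) fun b ↦ ?_
  rw [Real.norm_eq_abs]
  refine abs_le_of_sq_le_sq ?_ (by positivity)
  rw [mul_pow, Real.sq_sqrt (by positivity), ← differential_chartDeriv hy hf]
  refine (differential_sq_le g f _ _).trans ?_
  rw [mul_comm Lam, mul_assoc]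
  gcongr
  exact h b

/-- The formula `g(∇f, ∇h) = g^{ij} ∂_i f ∂_j h`. -/
theorem gradInner_eq_inv (g : SmoothMetric n M) {p : M} {y : E} (hy : y ∈ (φ p).target)
    {f h : M → ℝ} (hf : MDifferentiableAt (𝓡 n) 𝓘(ℝ, ℝ) f ((φ p).symm y))
    (hh : MDifferentiableAt (𝓡 n) 𝓘(ℝ, ℝ) h ((φ p).symm y)) :
    gradInner g f h ((φ p).symm y) = ∑ i, ∑ j, (gramMatrix g p y)⁻¹ i j *
      fderiv ℝ (f ∘ (φ p).symm) y (EuclideanSpace.single i 1) *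
      fderiv ℝ (h ∘ (φ p).symm) y (EuclideanSpace.single j 1) := by
  obtain ⟨a, ha, hab⟩ := exists_coord_grad g hy hf
  obtain ⟨b, hb, hbb⟩ := exists_coord_grad g hy hh
  have hdet := (gramMatrix_posDef g hy).det_pos.ne'.isUnit
  set G := gramMatrix g p y with hG
  have hb' : b.ofLp = G⁻¹.mulVec
      (fun j ↦ fderiv ℝ (h ∘ (φ p).symm) y (EuclideanSpace.single j 1)) := by
    have : G.mulVec b.ofLp =
        fun j ↦ fderiv ℝ (h ∘ (φ p).symm) y (EuclideanSpace.single j 1) := by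
      ext j
      rw [← hbb, coordForm_symm, coordForm_eq_dotProduct]
      simp [← hG]
    rw [← this, Matrix.mulVec_mulVec, Matrix.nonsing_inv_mul _ hdet, Matrix.one_mulVec]
  have e : gradInner g f h ((φ p).symm y) = coordForm g p y a b := by
    rw [gradInner, ha, hb]; rfl
  have hs : b = ∑ i, b i • EuclideanSpace.single i (1 : ℝ) := by
    ext j
    simp [Finset.sum_apply, Pi.single_apply]
  rw [e, hab]
  conv_lhs => rw [hs, map_sum]
  refine Finset.sum_congr rfl fun i _ ↦ ?_
  rw [map_smul, smul_eq_mul, hb', Matrix.mulVec, dotProduct, Finset.sum_mul]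
  exact Finset.sum_congr rfl fun j _ ↦ by ring

theorem IsSmooth.contDiffOn {f : M → ℝ} (hf : IsSmooth (n := n) f) (p : M) :
    ContDiffOn ℝ ∞ (f ∘ (φ p).symm) (φ p).target := by
  rw [← contMDiffOn_iff_contDiffOn]
  exact ContMDiff.comp_contMDiffOn hf (contMDiffOn_extChartAt_symm p)

omit [IsManifold (𝓡 n) ∞ M] in
theorem IsSmooth.mdifferentiableAt {f : M → ℝ} (hf : IsSmooth (n := n) f) (m : M) :
    MDifferentiableAt (𝓡 n) 𝓘(ℝ, ℝ) f m :=
  ContMDiff.mdifferentiable hf (by simp) m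

theorem continuous_gradInner (g : SmoothMetric n M) {f h : M → ℝ} (hf : IsSmooth (n := n) f)
    (hh : IsSmooth (n := n) h) : Continuous (gradInner g f h) := by
  rw [continuous_iff_continuousAt]
  intro p
  have hd : ∀ {f : M → ℝ}, IsSmooth (n := n) f → ∀ a : E,
      ContinuousOn (fun y ↦ fderiv ℝ (f ∘ (φ p).symm) y a) (φ p).target := fun hf a ↦
    ((hf.contDiffOn p).continuousOn_fderiv_of_isOpen (isOpen_extChartAt_target p)
      (by simp)).clm_apply continuousOn_const
  have hG : ∀ i j, ContinuousOn (fun y ↦ (gramMatrix g p y)⁻¹ i j) (φ p).target := fun i j ↦ by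
    simp only [Matrix.inv_def, Ring.inverse_eq_inv', Matrix.smul_apply, smul_eq_mul]
    have h1 : Continuous fun A : Matrix (Fin n) (Fin n) ℝ ↦ A.det := continuous_id.matrix_det
    have h2 : Continuous fun A : Matrix (Fin n) (Fin n) ℝ ↦ A.adjugate i j :=
      continuous_id.matrix_adjugate.matrix_elem i j
    exact ((h1.comp_continuousOn (continuousOn_gramMatrix g p)).inv₀
      fun y hy ↦ (gramMatrix_posDef g hy).det_pos.ne').mul
      (h2.comp_continuousOn (continuousOn_gramMatrix g p))
  have h1 : ContinuousOn (fun y ↦ gradInner g f h ((φ p).symm y)) (φ p).target := by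
    refine ContinuousOn.congr (f := fun y ↦ ∑ i, ∑ j, (gramMatrix g p y)⁻¹ i j *
      fderiv ℝ (f ∘ (φ p).symm) y (EuclideanSpace.single i 1) *
      fderiv ℝ (h ∘ (φ p).symm) y (EuclideanSpace.single j 1)) ?_ fun y hy ↦
        gradInner_eq_inv g hy (hf.mdifferentiableAt _) (hh.mdifferentiableAt _)
    exact continuousOn_finsetSum _ fun i _ ↦ continuousOn_finsetSum _ fun j _ ↦
      ((hG i j).mul (hd hf _)).mul (hd hh _)
  have h2 : ContinuousOn (gradInner g f h) (φ p).source := by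
    refine (h1.comp (continuousOn_extChartAt p) (φ p).mapsTo).congr fun m hm ↦ ?_
    simp only [Function.comp, (φ p).left_inv hm]
  exact h2.continuousAt (extChartAt_source_mem_nhds p)

end ChartCalculus

/-! ### The Riemannian volume in a chart -/

section Volume

variable {n : ℕ} {M : Type*} [TopologicalSpace M] [ChartedSpace (EuclideanSpace ℝ (Fin n)) M]
  [IsManifold (𝓡 n) ∞ M]

local notation "E" => EuclideanSpace ℝ (Fin n)
local notation "φ" => extChartAt (𝓡 n)

section Transition

variable {p q : M} {z : EuclideanSpace ℝ (Fin n)}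

theorem differentiableAt_transition (hz : z ∈ (φ q).target) (hp : (φ q).symm z ∈ (φ p).source) :
    DifferentiableAt ℝ (φ p ∘ (φ q).symm) z := by
  rw [← mdifferentiableAt_iff_differentiableAt]
  exact (mdifferentiableAt_extChartAt (by simpa using hp)).comp z (mdifferentiableAt_symm hz)

theorem chartDeriv_transition (hz : z ∈ (φ q).target) (hp : (φ q).symm z ∈ (φ p).source) (a : E) :
    chartDeriv n q z a =
      chartDeriv n p (φ p ((φ q).symm z)) (fderiv ℝ (φ p ∘ (φ q).symm) z a) := by
  have h1 : (φ q).symm =ᶠ[𝓝 z] (φ p).symm ∘ (φ p ∘ (φ q).symm) := by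
    filter_upwards [((continuousOn_extChartAt_symm q).continuousAt
      ((isOpen_extChartAt_target q).mem_nhds hz)).preimage_mem_nhds
        ((isOpen_extChartAt_source p).mem_nhds hp)] with y hy
    exact ((φ p).left_inv hy).symm
  have h2 := mfderiv_comp z (mdifferentiableAt_symm (p := p) (y := φ p ((φ q).symm z))
    ((φ p).map_source hp)) (differentiableAt_transition hz hp).mdifferentiableAt
  rw [mfderiv_eq_fderiv] at h2
  have h3 : chartDeriv n q z =
      mfderiv (𝓡 n) (𝓡 n) ((φ p).symm ∘ (φ p ∘ (φ q).symm)) z := h1.mfderiv_eq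
  rw [h3, h2]
  rfl

theorem coordForm_transition (g : SmoothMetric n M) (hz : z ∈ (φ q).target)
    (hp : (φ q).symm z ∈ (φ p).source) (a b : E) :
    coordForm g q z a b = coordForm g p (φ p ((φ q).symm z))
      (fderiv ℝ (φ p ∘ (φ q).symm) z a) (fderiv ℝ (φ p ∘ (φ q).symm) z b) := by
  rw [coordForm, chartDeriv_transition hz hp, chartDeriv_transition hz hp, coordForm,
    (φ p).left_inv hp]

/-- The transformation rule of the volume density under a change of charts. -/
theorem sqrt_det_transition (g : SmoothMetric n M) (hz : z ∈ (φ q).target)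
    (hp : (φ q).symm z ∈ (φ p).source) :
    √(gramMatrix g q z).det = |(fderiv ℝ (φ p ∘ (φ q).symm) z).det| *
      √(gramMatrix g p (φ p ((φ q).symm z))).det := by
  set A := fderiv ℝ (φ p ∘ (φ q).symm) z with hA
  set G := gramMatrix g p (φ p ((φ q).symm z)) with hG
  let b := (EuclideanSpace.basisFun (Fin n) ℝ).toBasis
  let J : Matrix (Fin n) (Fin n) ℝ := LinearMap.toMatrix b b (A : E →ₗ[ℝ] E)
  have hJ : ∀ k i, J k i = A (EuclideanSpace.single i 1) k := fun k i ↦ by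
    simp [J, b, LinearMap.toMatrix_apply]
  have hdet : A.det = J.det := (LinearMap.det_toMatrix b _).symm
  have h1 : gramMatrix g q z = J.transpose * G * J := by
    ext i j
    rw [gramMatrix_apply, coordForm_transition g hz hp, coordForm_eq, ← hA]
    simp only [Matrix.mul_apply, Matrix.transpose_apply, Finset.sum_mul, hJ, ← hG]
    rw [Finset.sum_comm]
    exact Finset.sum_congr rfl fun i _ ↦ Finset.sum_congr rfl fun j _ ↦ by ring
  rw [h1, Matrix.det_mul, Matrix.det_mul, Matrix.det_transpose, hdet,
    show J.det * G.det * J.det = J.det ^ 2 * G.det by ring, Real.sqrt_mul (sq_nonneg _),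
    Real.sqrt_sq_eq_abs]

end Transition

variable [MeasurableSpace M] [BorelSpace M]

omit [IsManifold (𝓡 n) ∞ M] in
theorem measurableSet_target_inter (p : M) {A : Set M} (hA : MeasurableSet A) :
    MeasurableSet ((φ p).target ∩ (φ p).symm ⁻¹' A) := by
  have h1 : Measurable ((φ p).target.domRestrict (φ p).symm) :=
    (continuousOn_iff_continuous_domRestrict.1 (continuousOn_extChartAt_symm p)).measurable
  have h2 := ((isOpen_extChartAt_target p).measurableSet).subtype_image (h1 hA)
  rwa [Set.domRestrict_eq, Set.preimage_comp, Subtype.image_preimage_coe] at h2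

omit [IsManifold (𝓡 n) ∞ M] in
theorem measurableSet_source_inter (p : M) {K : Set E} (hK : MeasurableSet K) :
    MeasurableSet ((φ p).source ∩ φ p ⁻¹' K) := by
  have h1 : Measurable ((φ p).source.domRestrict (φ p)) :=
    (continuousOn_iff_continuous_domRestrict.1 (continuousOn_extChartAt p)).measurable
  have h2 := ((isOpen_extChartAt_source p).measurableSet).subtype_image (h1 hK)
  rwa [Set.domRestrict_eq, Set.preimage_comp, Subtype.image_preimage_coe] at h2

omit [MeasurableSpace M] [BorelSpace M] in
theorem aemeasurable_density (g : SmoothMetric n M) (p : M) :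
    AEMeasurable (fun y ↦ ENNReal.ofReal (√(gramMatrix g p y).det))
      (volume.restrict (φ p).target) :=
  ((continuousOn_sqrt_det g p).aemeasurable (isOpen_extChartAt_target p).measurableSet).ennreal_ofReal

theorem aemeasurable_symm (g : SmoothMetric n M) (p : M) : AEMeasurable (φ p).symm
    ((volume.restrict (φ p).target).withDensity
      (fun y ↦ ENNReal.ofReal (√(gramMatrix g p y).det))) :=
  ((continuousOn_extChartAt_symm p).aemeasurable
    (isOpen_extChartAt_target p).measurableSet).mono_ac (withDensity_absolutelyContinuous _ _)

theorem chartVolume_apply (g : SmoothMetric n M) (p : M) {A : Set M} (hA : MeasurableSet A) :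
    chartVolume g p A = ∫⁻ y in (φ p).target ∩ (φ p).symm ⁻¹' A,
      ENNReal.ofReal (√(gramMatrix g p y).det) := by
  rw [chartVolume, Measure.map_apply_of_aemeasurable (aemeasurable_symm g p) hA,
    withDensity_apply', Measure.restrict_restrict' (isOpen_extChartAt_target p).measurableSet,
    Set.inter_comm]

theorem chartVolume_inter_source (g : SmoothMetric n M) (p : M) {A : Set M}
    (hA : MeasurableSet A) : chartVolume g p (A ∩ (φ p).source) = chartVolume g p A := by
  rw [chartVolume_apply g p hA,
    chartVolume_apply g p (hA.inter (isOpen_extChartAt_source p).measurableSet)]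
  congr 2
  ext y
  constructor
  · rintro ⟨h1, h2, -⟩; exact ⟨h1, h2⟩
  · rintro ⟨h1, h2⟩; exact ⟨h1, h2, (φ p).map_target h1⟩

/-- The volumes of two charts agree on the intersection of their domains, by the change of
variables formula. -/
theorem chartVolume_eq (g : SmoothMetric n M) (p q : M) {A : Set M} (hA : MeasurableSet A)
    (hp : A ⊆ (φ p).source) (hq : A ⊆ (φ q).source) : chartVolume g p A = chartVolume g q A := by
  have himg : (φ p ∘ (φ q).symm) '' ((φ q).target ∩ (φ q).symm ⁻¹' A) =
      (φ p).target ∩ (φ p).symm ⁻¹' A := by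
    ext y
    constructor
    · rintro ⟨z, ⟨hz, hzA⟩, rfl⟩
      refine ⟨(φ p).map_source (hp hzA), ?_⟩
      simp only [Set.mem_preimage, Function.comp] at hzA ⊢
      rwa [(φ p).left_inv (hp hzA)]
    · rintro ⟨hy, hyA⟩
      refine ⟨φ q ((φ p).symm y), ⟨(φ q).map_source (hq hyA), ?_⟩, ?_⟩
      · simp only [Set.mem_preimage] at hyA ⊢
        rwa [(φ q).left_inv (hq hyA)]
      · simp only [Function.comp, (φ q).left_inv (hq hyA), (φ p).right_inv hy]
  rw [chartVolume_apply g p hA, chartVolume_apply g q hA, ← himg,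
    lintegral_image_eq_lintegral_abs_det_fderiv_mul volume (measurableSet_target_inter q hA)
      (f' := fun z ↦ fderiv ℝ (φ p ∘ (φ q).symm) z)
      (fun z hz ↦ (differentiableAt_transition hz.1 (hp hz.2)).hasFDerivAt.hasFDerivWithinAt) ?_]
  · refine setLIntegral_congr_fun (measurableSet_target_inter q hA) fun z hz ↦ ?_
    simp only [Function.comp]
    rw [sqrt_det_transition g hz.1 (hp hz.2), ENNReal.ofReal_mul (abs_nonneg _)]
  · intro z hz z' hz' h
    exact (φ q).symm.injOn hz.1 hz'.1 ((φ p).injOn (hp hz.2) (hp hz'.2) h)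

/-- The volume restricts to the chart volume on the chart domain. -/
theorem vol_restrict (g : SmoothMetric n M) (p : M) {A : Set M} (hA : MeasurableSet A)
    (hp : A ⊆ (φ p).source) : (vol g).restrict A = (chartVolume g p).restrict A := by
  refine le_antisymm ?_ (Measure.restrict_mono subset_rfl (le_iSup (chartVolume g) p))
  -- The measure on the right is above all the chart volumes, and it agrees with the volume of the
  -- chart around `p` on `A`.
  have hle : vol g ≤ (chartVolume g p).restrict A + (vol g).restrict Aᶜ := by
    refine iSup_le fun q ↦ ?_
    rw [← Measure.restrict_add_restrict_compl (μ := chartVolume g q) hA]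
    refine add_le_add (Measure.le_iff.2 fun B hB ↦ ?_)
      (Measure.restrict_mono subset_rfl (le_iSup (chartVolume g) q))
    rw [Measure.restrict_apply hB, Measure.restrict_apply hB,
      ← chartVolume_inter_source g q (hB.inter hA),
      ← chartVolume_eq g p q ((hB.inter hA).inter (isOpen_extChartAt_source q).measurableSet)
        (fun m hm ↦ hp hm.1.2) (fun m hm ↦ hm.2)]
    exact measure_mono Set.inter_subset_left
  refine (Measure.restrict_mono subset_rfl hle).trans_eq ?_
  rw [Measure.restrict_add, Measure.restrict_restrict hA, Measure.restrict_restrict hA,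
    Set.inter_self, Set.inter_compl_self, Measure.restrict_empty, add_zero]

/-- Integration over the part of a chart domain with coordinates in `K`. -/
theorem setLIntegral_vol (g : SmoothMetric n M) (p : M) {K : Set E} (hK : MeasurableSet K)
    (hKt : K ⊆ (φ p).target) {F : M → ℝ≥0∞} (hF : Measurable F) :
    ∫⁻ m in (φ p).source ∩ φ p ⁻¹' K, F m ∂(vol g) =
      ∫⁻ y in K, ENNReal.ofReal (√(gramMatrix g p y).det) * F ((φ p).symm y) := by
  have hA := measurableSet_source_inter p hK
  set A := (φ p).source ∩ φ p ⁻¹' K with hAdef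
  rw [vol_restrict g p hA Set.inter_subset_left, ← lintegral_indicator hA, chartVolume,
    lintegral_map' (hF.indicator hA).aemeasurable (aemeasurable_symm g p)]
  have h1 : AEMeasurable (fun y ↦ A.indicator F ((φ p).symm y)) (volume.restrict (φ p).target) :=
    (hF.indicator hA).comp_aemeasurable ((continuousOn_extChartAt_symm p).aemeasurable
      (isOpen_extChartAt_target p).measurableSet)
  rw [lintegral_withDensity_eq_lintegral_mul₀ (aemeasurable_density g p) h1,
    ← lintegral_indicator (isOpen_extChartAt_target p).measurableSet, ← lintegral_indicator hK]
  refine lintegral_congr fun y ↦ ?_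
  by_cases hy : y ∈ K
  · have h2 : (φ p).symm y ∈ A := ⟨(φ p).map_target (hKt hy), by
      simpa only [Set.mem_preimage, (φ p).right_inv (hKt hy)] using hy⟩
    rw [Set.indicator_of_mem (hKt hy), Set.indicator_of_mem hy]
    simp only [Pi.mul_apply, Set.indicator_of_mem h2]
  · rw [Set.indicator_of_notMem hy]
    by_cases hyt : y ∈ (φ p).target
    · have h2 : (φ p).symm y ∉ A := fun h ↦ hy (by
        have := h.2
        rwa [Set.mem_preimage, (φ p).right_inv hyt] at this)
      rw [Set.indicator_of_mem hyt]
      simp only [Pi.mul_apply, Set.indicator_of_notMem h2, mul_zero]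
    · rw [Set.indicator_of_notMem hyt]

theorem vol_chart (g : SmoothMetric n M) (p : M) {K : Set E} (hK : MeasurableSet K)
    (hKt : K ⊆ (φ p).target) :
    vol g ((φ p).source ∩ φ p ⁻¹' K) = ∫⁻ y in K, ENNReal.ofReal (√(gramMatrix g p y).det) := by
  have := setLIntegral_vol g p hK hKt (F := fun _ ↦ 1) measurable_const
  simpa using this

theorem vol_pos_of_isOpen (g : SmoothMetric n M) {U : Set M} (hU : IsOpen U) (hne : U.Nonempty) :
    0 < vol g U := by
  obtain ⟨p, hp⟩ := hne
  set K := (φ p).target ∩ (φ p).symm ⁻¹' U with hK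
  have hKo : IsOpen K :=
    (continuousOn_extChartAt_symm p).isOpen_inter_preimage (isOpen_extChartAt_target p) hU
  have h1 : (φ p).source ∩ φ p ⁻¹' K ⊆ U := by
    rintro m ⟨h1, h2⟩
    have := h2.2
    rwa [Set.mem_preimage, (φ p).left_inv h1] at this
  refine lt_of_lt_of_le ?_ (measure_mono h1)
  rw [vol_chart g p hKo.measurableSet Set.inter_subset_left]
  rw [pos_iff_ne_zero, Ne, lintegral_eq_zero_iff'
    ((aemeasurable_density g p).mono_set Set.inter_subset_left)]
  intro h0
  have h2 : ∀ᵐ y ∂(volume.restrict K), y ∉ K := by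
    filter_upwards [h0] with y hy hyK
    rw [Pi.zero_apply, ENNReal.ofReal_eq_zero] at hy
    exact (sqrt_det_pos g hyK.1).not_ge hy
  rw [ae_restrict_iff' hKo.measurableSet] at h2
  refine (hKo.measure_pos volume ⟨φ p p, mem_extChartAt_target p, ?_⟩).ne' ?_
  · simp [hp]
  · refine measure_mono_null (fun y hy ↦ ?_) h2
    simpa using hy

end Volume

/-! ### The Poincaré inequality on convex sets -/

section Poincare

variable {n : ℕ}

local notation "E" => EuclideanSpace ℝ (Fin n)

/-- The Cauchy–Schwarz inequality on the unit interval. -/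
theorem sq_integral_le {u : ℝ → ℝ} (hu : ContinuousOn u (Set.Icc 0 1)) :
    (∫ t in (0 : ℝ)..1, u t) ^ 2 ≤ ∫ t in (0 : ℝ)..1, u t ^ 2 := by
  have hu' : ContinuousOn u (Set.uIcc 0 1) := by rwa [Set.uIcc_of_le zero_le_one]
  set a := ∫ t in (0 : ℝ)..1, u t with ha
  have h0 : 0 ≤ ∫ t in (0 : ℝ)..1, (u t - a) ^ 2 :=
    intervalIntegral.integral_nonneg zero_le_one fun t _ ↦ sq_nonneg _
  have h1 : ∫ t in (0 : ℝ)..1, (u t - a) ^ 2 =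
      (∫ t in (0 : ℝ)..1, u t ^ 2) - 2 * a * (∫ t in (0 : ℝ)..1, u t) + a ^ 2 := by
    have i1 : IntervalIntegrable (fun t ↦ u t ^ 2) volume 0 1 := (hu'.pow 2).intervalIntegrable
    have i2 : IntervalIntegrable (fun t ↦ 2 * a * u t) volume 0 1 :=
      (hu'.const_smul (2 * a)).intervalIntegrable
    rw [← intervalIntegral.integral_const_mul, ← intervalIntegral.integral_sub i1 i2]
    have i3 : IntervalIntegrable (fun _ : ℝ ↦ a ^ 2) volume 0 1 := intervalIntegrable_const
    have : a ^ 2 = ∫ t in (0 : ℝ)..1, a ^ 2 := by simp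
    conv_rhs => rw [this]
    rw [← intervalIntegral.integral_add (i1.sub i2) i3]
    congr 1
    ext t
    ring
  rw [h1, ← ha] at h0
  nlinarith

/-- The difference of two values is controlled by the derivative along the segment. -/
theorem sq_sub_le_lintegral {U : Set E} (hU : IsOpen U) {F : E → ℝ} (hF : ContDiffOn ℝ 1 F U)
    {x y : E} (hxy : ∀ t ∈ Set.Icc (0 : ℝ) 1, y + t • (x - y) ∈ U) {d : ℝ} (hd : ‖x - y‖ ≤ d) :
    ENNReal.ofReal ((F x - F y) ^ 2) ≤ ENNReal.ofReal (d ^ 2) *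
      ∫⁻ t in Set.Icc (0 : ℝ) 1, ENNReal.ofReal (‖fderiv ℝ F (y + t • (x - y))‖ ^ 2) := by
  let γ : ℝ → E := fun t ↦ y + t • (x - y)
  have hγ : Continuous γ := by fun_prop
  have hγ' : ∀ t, HasDerivAt γ (x - y) t := fun t ↦ by
    have := ((hasDerivAt_id t).smul_const (x - y)).const_add y
    rwa [one_smul] at this
  have hder : ∀ t ∈ Set.Icc (0 : ℝ) 1,
      HasDerivAt (F ∘ γ) (fderiv ℝ F (γ t) (x - y)) t := fun t ht ↦
    ((hF.differentiableOn (by simp)).differentiableAt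
      (hU.mem_nhds (hxy t ht))).hasFDerivAt.comp_hasDerivAt t (hγ' t)
  have hDc : ContinuousOn (fun t ↦ fderiv ℝ F (γ t)) (Set.Icc (0 : ℝ) 1) :=
    (hF.continuousOn_fderiv_of_isOpen hU le_rfl).comp hγ.continuousOn hxy
  have hc : ContinuousOn (fun t ↦ fderiv ℝ F (γ t) (x - y)) (Set.Icc (0 : ℝ) 1) :=
    hDc.clm_apply continuousOn_const
  have hFTC : ∫ t in (0 : ℝ)..1, fderiv ℝ F (γ t) (x - y) = F x - F y := by
    rw [intervalIntegral.integral_eq_sub_of_hasDerivAt (f := F ∘ γ)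
      (by rwa [Set.uIcc_of_le zero_le_one])
      (ContinuousOn.intervalIntegrable (by rwa [Set.uIcc_of_le zero_le_one]))]
    simp [γ]
  have hle : (F x - F y) ^ 2 ≤ ∫ t in Set.Icc (0 : ℝ) 1, d ^ 2 * ‖fderiv ℝ F (γ t)‖ ^ 2 := by
    rw [← hFTC]
    refine (sq_integral_le hc).trans ?_
    rw [intervalIntegral.integral_of_le zero_le_one, ← integral_Icc_eq_integral_Ioc]
    refine setIntegral_mono_on ((hc.pow 2).integrableOn_Icc)
      ((continuousOn_const.mul (hDc.norm.pow 2)).integrableOn_Icc) measurableSet_Icc fun t _ ↦ ?_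
    rw [← sq_abs, ← mul_pow, mul_comm]
    have := (fderiv ℝ F (γ t)).le_opNorm (x - y)
    rw [Real.norm_eq_abs] at this
    gcongr
    exact this.trans (by gcongr)
  refine (ENNReal.ofReal_le_ofReal hle).trans_eq ?_
  have hi : IntegrableOn (fun t ↦ d ^ 2 * ‖fderiv ℝ F (γ t)‖ ^ 2) (Set.Icc 0 1) :=
    (continuousOn_const.mul (hDc.norm.pow 2)).integrableOn_Icc
  rw [ofReal_integral_eq_lintegral_ofReal hi (Eventually.of_forall fun t ↦ by positivity),
    ← lintegral_const_mul' _ _ ENNReal.ofReal_ne_top]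
  congr 1
  ext t
  rw [ENNReal.ofReal_mul (sq_nonneg d)]

/-- Contracting a convex set by a factor at least `1 / 2` towards one of its points. -/
theorem setLIntegral_contract_le {K : Set E} (hK : Convex ℝ K) (hKm : MeasurableSet K)
    {h : E → ℝ≥0∞} (hh : Measurable h) {y : E} (hy : y ∈ K) {t : ℝ} (ht : 1 / 2 ≤ t)
    (ht1 : t ≤ 1) :
    ∫⁻ x in K, h (y + t • (x - y)) ≤ 2 ^ n * ∫⁻ x in K, h x := by
  have ht0 : 0 < t := by linarith
  have h1 : ∫⁻ x in K, h (y + t • (x - y)) ≤ ∫⁻ x, K.indicator h (y + t • (x - y)) := by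
    rw [← lintegral_indicator hKm]
    refine lintegral_mono fun x ↦ ?_
    by_cases hx : x ∈ K
    · have : y + t • (x - y) ∈ K := hK.add_smul_sub_mem hy hx ⟨ht0.le, ht1⟩
      simp [Set.indicator_of_mem hx, Set.indicator_of_mem this]
    · simp [Set.indicator_of_notMem hx]
  refine h1.trans ?_
  rw [← lintegral_indicator hKm]
  set k := K.indicator h with hk
  have hkm : Measurable k := hh.indicator hKm
  have h2 : ∫⁻ x, k (y + t • (x - y)) = ∫⁻ x, k (t • x) := by
    rw [← lintegral_sub_right_eq_self (fun x ↦ k (t • x)) ((1 - t⁻¹) • y)]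
    refine lintegral_congr fun x ↦ ?_
    congr 1
    simp only [smul_sub, sub_smul, one_smul, smul_smul, mul_inv_cancel₀ ht0.ne']
    abel
  have h3 : ∫⁻ x, k (t • x) = ENNReal.ofReal |(t ^ n)⁻¹| * ∫⁻ x, k x := by
    have := Measure.map_addHaar_smul (volume : Measure E) ht0.ne'
    rw [← lintegral_map (f := k) (g := fun x ↦ t • x) hkm (measurable_const_smul t), this,
      lintegral_smul_measure, finrank_euclideanSpace_fin, smul_eq_mul]
  rw [h2, h3]
  gcongr
  rw [abs_of_pos (by positivity), show (2 : ℝ≥0∞) ^ n = ENNReal.ofReal (2 ^ n) by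
    rw [ENNReal.ofReal_pow zero_le_two]; simp, ← inv_pow]
  refine ENNReal.ofReal_le_ofReal ?_
  gcongr
  rw [inv_le_comm₀ ht0 two_pos]
  linarith

/-- The Poincaré inequality on a convex set, in the form of double integrals. -/
theorem poincare_convex {U : Set E} (hU : IsOpen U) {F : E → ℝ} (hF : ContDiffOn ℝ 1 F U)
    {K : Set E} (hK : Convex ℝ K) (hKm : MeasurableSet K) (hKU : K ⊆ U) {d : ℝ}
    (hd : ∀ x ∈ K, ∀ y ∈ K, ‖x - y‖ ≤ d) :
    ∫⁻ x in K, ∫⁻ y in K, ENNReal.ofReal ((F x - F y) ^ 2) ≤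
      ENNReal.ofReal (d ^ 2) * (2 ^ n * volume K *
        ∫⁻ x in K, ENNReal.ofReal (‖fderiv ℝ F x‖ ^ 2)) := by
  let h : E → ℝ≥0∞ := U.indicator fun x ↦ ENNReal.ofReal (‖fderiv ℝ F x‖ ^ 2)
  have hh : Measurable h := by
    have hc : ContinuousOn (fun x ↦ ENNReal.ofReal (‖fderiv ℝ F x‖ ^ 2)) U :=
      ENNReal.continuous_ofReal.comp_continuousOn
        ((hF.continuousOn_fderiv_of_isOpen hU le_rfl).norm.pow 2)
    classical
    have := hc.measurable_piecewise (continuousOn_const (c := (0 : ℝ≥0∞))) hU.measurableSet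
    rwa [← Pi.zero_def, Set.piecewise_eq_indicator] at this
  have hhK : ∫⁻ x in K, ENNReal.ofReal (‖fderiv ℝ F x‖ ^ 2) = ∫⁻ x in K, h x :=
    setLIntegral_congr_fun hKm fun x hx ↦ by simp [h, Set.indicator_of_mem (hKU hx)]
  have hseg : ∀ x ∈ K, ∀ y ∈ K, ∀ t ∈ Set.Icc (0 : ℝ) 1, y + t • (x - y) ∈ K :=
    fun x hx y hy t ht ↦ hK.add_smul_sub_mem hy hx ht
  calc ∫⁻ x in K, ∫⁻ y in K, ENNReal.ofReal ((F x - F y) ^ 2)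
      ≤ ∫⁻ x in K, ∫⁻ y in K, ENNReal.ofReal (d ^ 2) *
          ∫⁻ t in Set.Icc (0 : ℝ) 1, h (y + t • (x - y)) := by
        refine setLIntegral_mono' hKm fun x hx ↦ setLIntegral_mono' hKm fun y hy ↦ ?_
        refine (sq_sub_le_lintegral hU hF (fun t ht ↦ hKU (hseg x hx y hy t ht))
          (hd x hx y hy)).trans_eq ?_
        congr 1
        refine setLIntegral_congr_fun measurableSet_Icc fun t ht ↦ ?_
        simp [h, Set.indicator_of_mem (hKU (hseg x hx y hy t ht))]
    _ = ENNReal.ofReal (d ^ 2) * ∫⁻ t in Set.Icc (0 : ℝ) 1, ∫⁻ x in K, ∫⁻ y in K,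
          h (y + t • (x - y)) := by
        simp_rw [lintegral_const_mul' _ _ ENNReal.ofReal_ne_top]
        congr 1
        have e1 : ∀ x, ∫⁻ y in K, ∫⁻ t in Set.Icc (0 : ℝ) 1, h (y + t • (x - y)) =
            ∫⁻ t in Set.Icc (0 : ℝ) 1, ∫⁻ y in K, h (y + t • (x - y)) := fun x ↦
          lintegral_lintegral_swap (hh.comp (by fun_prop : Measurable fun z : E × ℝ ↦
            z.1 + z.2 • (x - z.1))).aemeasurable
        simp_rw [e1]
        refine lintegral_lintegral_swap (Measurable.aemeasurable ?_)
        have : Measurable fun z : (E × ℝ) × E ↦ h (z.2 + z.1.2 • (z.1.1 - z.2)) :=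
          hh.comp (by fun_prop)
        exact this.lintegral_prod_right'
    _ ≤ ENNReal.ofReal (d ^ 2) * ∫⁻ t in Set.Icc (0 : ℝ) 1,
          (2 ^ n * volume K * ∫⁻ x in K, h x) := by
        refine mul_le_mul' le_rfl (setLIntegral_mono' measurableSet_Icc fun t ht ↦ ?_)
        have hm2 : Measurable fun z : E × E ↦ h (z.2 + t • (z.1 - z.2)) := hh.comp (by fun_prop)
        -- Contract towards `y` for large `t` and towards `x` for small `t`.
        rcases le_total (1 / 2) t with h2 | h2
        · rw [lintegral_lintegral_swap hm2.aemeasurable]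
          refine (setLIntegral_mono' hKm fun y hy ↦
            setLIntegral_contract_le hK hKm hh hy h2 ht.2).trans_eq ?_
          rw [setLIntegral_const]
          ring
        · refine (setLIntegral_mono' (g := fun _ ↦ 2 ^ n * ∫⁻ x in K, h x) hKm
            fun x hx ↦ ?_).trans_eq ?_
          · refine le_trans (le_of_eq ?_)
              (setLIntegral_contract_le hK hKm hh hx (t := 1 - t) (by linarith) (by linarith [ht.1]))
            refine lintegral_congr fun y ↦ ?_
            congr 1
            simp only [smul_sub, sub_smul, one_smul]
            abel
          · rw [setLIntegral_const]
            ring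
    _ = _ := by
        rw [setLIntegral_const, hhK]
        simp

/-- A bounded convex set is a finite disjoint union of convex sets of small diameter. -/
theorem exists_convex_partition {B : Set E} (hB : Convex ℝ B) (hBm : MeasurableSet B)
    (hBb : Bornology.IsBounded B) {d : ℝ} (hd : 0 < d) :
    ∃ (s : Finset (Fin n → ℤ)) (K : (Fin n → ℤ) → Set E), (B = ⋃ i ∈ s, K i) ∧
      (∀ i, Convex ℝ (K i)) ∧ (∀ i, MeasurableSet (K i)) ∧ Pairwise (Function.onFun Disjoint K) ∧
      ∀ i, ∀ x ∈ K i, ∀ y ∈ K i, ‖x - y‖ ≤ d := by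
  set h := d / (n + 1) with hh
  have hh0 : 0 < h := by positivity
  let c : E → Fin n → ℤ := fun x j ↦ ⌊x j / h⌋
  obtain ⟨R, hR⟩ := hBb.exists_norm_le
  have hfin : (c '' B).Finite := by
    refine (Set.Finite.pi' (t := fun _ : Fin n ↦ Set.Icc ⌊-R / h⌋ ⌊R / h⌋)
      fun _ ↦ Set.finite_Icc _ _).subset ?_
    rintro _ ⟨x, hx, rfl⟩ j
    have h1 : |x j| ≤ R := (PiLp.norm_apply_le x j).trans (hR x hx)
    rw [abs_le] at h1
    exact ⟨Int.floor_le_floor (by gcongr; exact h1.1), Int.floor_le_floor (by gcongr; exact h1.2)⟩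
  have hcell : ∀ i, {x : E | c x = i} = ⋂ j, {x : E | (i j : ℝ) ≤ x j / h ∧ x j / h < i j + 1} := by
    intro i
    ext x
    simp only [Set.mem_ofPred_eq, Set.mem_iInter, funext_iff, c, Int.floor_eq_iff]
  refine ⟨hfin.toFinset, fun i ↦ B ∩ {x | c x = i}, ?_, fun i ↦ hB.inter ?_,
    fun i ↦ hBm.inter ?_, ?_, ?_⟩
  · ext x
    simp only [Set.Finite.mem_toFinset, Set.mem_image, Set.mem_iUnion, Set.mem_inter_iff,
      Set.mem_ofPred_eq, exists_prop]
    exact ⟨fun hx ↦ ⟨c x, ⟨x, hx, rfl⟩, hx, rfl⟩, fun ⟨_, _, hx, _⟩ ↦ hx⟩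
  · rw [hcell]
    refine convex_iInter fun j ↦ ?_
    let l : E →ₗ[ℝ] ℝ := h⁻¹ • (EuclideanSpace.proj j : E →L[ℝ] ℝ).toLinearMap
    have hl : ∀ x, l x = x j / h := fun x ↦ by
      simp [l, div_eq_inv_mul]
    have he : {x : E | (i j : ℝ) ≤ x j / h ∧ x j / h < i j + 1} =
        l ⁻¹' Set.Ico (i j : ℝ) (i j + 1) := by
      ext x
      rw [Set.mem_preimage, hl]
      rfl
    rw [he]
    exact (convex_Ico (i j : ℝ) (i j + 1)).linear_preimage l
  · rw [hcell]
    refine MeasurableSet.iInter fun j ↦ ?_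
    have : Measurable fun x : E ↦ x j / h := by fun_prop
    exact this measurableSet_Ico
  · intro i j hij
    refine Set.disjoint_left.2 fun x hx hx' ↦ hij ?_
    rw [← hx.2, ← hx'.2]
  · rintro i x ⟨-, hx⟩ y ⟨-, hy⟩
    have h1 : ∀ j, ‖(x - y) j‖ ≤ h := fun j ↦ by
      have e1 : |x j / h - y j / h| < 1 := Int.abs_sub_lt_one_of_floor_eq_floor (by
        have e1 := congrFun hx j
        have e2 := congrFun hy j
        simp only [c] at e1 e2
        rw [e1, e2])
      rw [← sub_div, abs_div, abs_of_pos hh0, div_lt_one hh0] at e1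
      simpa using e1.le
    rw [EuclideanSpace.norm_eq]
    refine Real.sqrt_le_iff.2 ⟨hd.le, ?_⟩
    calc ∑ j, ‖(x - y) j‖ ^ 2 ≤ ∑ _j : Fin n, h ^ 2 := by gcongr with j _; exact h1 j
      _ = n * h ^ 2 := by simp
      _ ≤ (n + 1) ^ 2 * h ^ 2 := by gcongr; nlinarith [(Nat.cast_nonneg n : (0 : ℝ) ≤ n)]
      _ = d ^ 2 := by rw [hh]; field_simp

end Poincare

/-! ### Cutoff functions in a chart -/

section Cutoff

variable {n : ℕ} {M : Type*} [TopologicalSpace M] [ChartedSpace (EuclideanSpace ℝ (Fin n)) M]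

local notation "E" => EuclideanSpace ℝ (Fin n)
local notation "φ" => extChartAt (𝓡 n)

variable (n) in
/-- The bump function on the model space which is `1` on the unit ball and is supported in the
ball of radius `2`. -/
def unitBump : ContDiffBump (0 : EuclideanSpace ℝ (Fin n)) := ⟨1, 2, zero_lt_one, one_lt_two⟩

theorem exists_norm_fderiv_unitBump_le : ∃ C > 0, ∀ y : E, ‖fderiv ℝ (unitBump n) y‖ ≤ C := by
  have h1 : Continuous (fderiv ℝ (unitBump n)) :=
    ((unitBump n).contDiff (n := 1)).continuous_fderiv (by simp)
  obtain ⟨C, hC⟩ := ((unitBump n).hasCompactSupport.fderiv (𝕜 := ℝ)).exists_bound_of_continuous h1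
  exact ⟨max C 1, by positivity, fun y ↦ (hC y).trans (le_max_left _ _)⟩

open Classical in
/-- The function on `M` which is, in the chart around `p`, a bump at `y₀` at scale `s`: it is `1`
at distance at most `s` from `y₀` and `0` at distance at least `2 s`. -/
def chartBump (p : M) (y₀ : E) (s : ℝ) (m : M) : ℝ :=
  if m ∈ (φ p).source then unitBump n (s⁻¹ • (φ p m - y₀)) else 0

variable {p : M} {y₀ : EuclideanSpace ℝ (Fin n)} {s : ℝ}

theorem chartBump_nonneg (m : M) : 0 ≤ chartBump p y₀ s m := by
  unfold chartBump
  split_ifs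
  exacts [(unitBump n).nonneg, le_rfl]

theorem chartBump_symm {y : E} (hy : y ∈ (φ p).target) :
    chartBump p y₀ s ((φ p).symm y) = unitBump n (s⁻¹ • (y - y₀)) := by
  rw [chartBump, if_pos ((φ p).map_target hy), (φ p).right_inv hy]

theorem chartBump_eq_one (hs : 0 < s) {m : M} (hm : m ∈ (φ p).source)
    (h : dist (φ p m) y₀ ≤ s) : chartBump p y₀ s m = 1 := by
  rw [chartBump, if_pos hm]
  refine (unitBump n).one_of_mem_closedBall ?_
  rw [mem_closedBall_zero_iff, norm_smul, norm_inv, Real.norm_of_nonneg hs.le, ← dist_eq_norm,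
    inv_mul_eq_div, div_le_iff₀ hs]
  simpa [unitBump] using h

theorem chartBump_eq_zero (hs : 0 < s) {m : M}
    (h : ¬ (m ∈ (φ p).source ∧ dist (φ p m) y₀ < 2 * s)) : chartBump p y₀ s m = 0 := by
  unfold chartBump
  split_ifs with hm
  · refine (unitBump n).zero_of_le_dist ?_
    rw [dist_zero_right, norm_smul, norm_inv, Real.norm_of_nonneg hs.le, ← dist_eq_norm,
      inv_mul_eq_div, le_div_iff₀ hs]
    exact not_lt.1 fun h' ↦ h ⟨hm, h'⟩
  · rfl

theorem isSmooth_chartBump [IsManifold (𝓡 n) ∞ M] [T2Space M] (hs : 0 < s)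
    (ht : Metric.closedBall y₀ (2 * s) ⊆ (φ p).target) :
    IsSmooth (n := n) (chartBump p y₀ s) := by
  intro m
  by_cases hm : m ∈ (φ p).source
  · have h1 : ContMDiffOn (𝓡 n) 𝓘(ℝ, ℝ) ∞
        ((fun y ↦ unitBump n (s⁻¹ • (y - y₀))) ∘ φ p) (φ p).source := by
      refine ContMDiff.comp_contMDiffOn (ContDiff.contMDiff ?_) (by
        rw [extChartAt_source]; exact contMDiffOn_extChartAt)
      exact (unitBump n).contDiff.comp (by fun_prop)
    refine (h1.contMDiffAt ((isOpen_extChartAt_source p).mem_nhds hm)).congr_of_eventuallyEq ?_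
    filter_upwards [(isOpen_extChartAt_source p).mem_nhds hm] with q hq
    rw [chartBump, if_pos hq]
    rfl
  · have hK : IsClosed ((φ p).symm '' Metric.closedBall y₀ (2 * s)) :=
      ((isCompact_closedBall _ _).image_of_continuousOn
        ((continuousOn_extChartAt_symm p).mono ht)).isClosed
    have hmK : m ∉ (φ p).symm '' Metric.closedBall y₀ (2 * s) := by
      rintro ⟨y, hy, rfl⟩
      exact hm ((φ p).map_target (ht hy))
    refine (contMDiffAt_const (c := (0 : ℝ))).congr_of_eventuallyEq ?_
    filter_upwards [hK.isOpen_compl.mem_nhds hmK] with q hq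
    refine chartBump_eq_zero hs fun h ↦ hq ⟨φ p q, ?_, (φ p).left_inv h.1⟩
    exact h.2.le

theorem fderiv_chartBump {y : E} (hy : y ∈ (φ p).target) :
    fderiv ℝ (chartBump p y₀ s ∘ (φ p).symm) y =
      s⁻¹ • fderiv ℝ (unitBump n) (s⁻¹ • (y - y₀)) := by
  have h1 : chartBump p y₀ s ∘ (φ p).symm =ᶠ[𝓝 y] fun y ↦ unitBump n (s⁻¹ • (y - y₀)) := by
    filter_upwards [(isOpen_extChartAt_target p).mem_nhds hy] with z hz
    exact chartBump_symm hz
  rw [h1.fderiv_eq]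
  have h2 : HasFDerivAt (fun y : E ↦ s⁻¹ • (y - y₀)) (s⁻¹ • ContinuousLinearMap.id ℝ E) y :=
    ((hasFDerivAt_id y).sub_const y₀).const_smul s⁻¹
  have h3 := (((unitBump n).contDiff (n := 1)).differentiable (by simp)
    (s⁻¹ • (y - y₀))).hasFDerivAt
  rw [show (fun y ↦ unitBump n (s⁻¹ • (y - y₀))) = unitBump n ∘ fun y ↦ s⁻¹ • (y - y₀) from rfl,
    (h3.comp y h2).fderiv]
  ext a
  simp

/-- The derivative of the bump at scale `s` is supported in the annulus of radii `s` and `2 s`. -/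
theorem fderiv_chartBump_eq_zero (hs : 0 < s) {y : E} (hy : y ∈ (φ p).target)
    (h : dist y y₀ < s ∨ 2 * s ≤ dist y y₀) :
    fderiv ℝ (chartBump p y₀ s ∘ (φ p).symm) y = 0 := by
  rw [fderiv_chartBump hy]
  have e : ‖s⁻¹ • (y - y₀)‖ = dist y y₀ / s := by
    rw [norm_smul, norm_inv, Real.norm_of_nonneg hs.le, ← dist_eq_norm, inv_mul_eq_div]
  suffices fderiv ℝ (unitBump n) (s⁻¹ • (y - y₀)) = 0 by rw [this, smul_zero]
  rcases h with h | h
  · have h1 : unitBump n =ᶠ[𝓝 (s⁻¹ • (y - y₀))] fun _ ↦ 1 :=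
      (unitBump n).eventuallyEq_one_of_mem_ball (by
        rw [mem_ball_zero_iff, e, div_lt_iff₀ hs]
        simpa [unitBump] using h)
    rw [h1.fderiv_eq]
    simp
  · -- The bump is nonnegative, so it has a minimum at each of its zeros.
    refine IsLocalMin.fderiv_eq_zero (Eventually.of_forall fun z ↦ ?_)
    rw [(unitBump n).zero_of_le_dist (x := s⁻¹ • (y - y₀)) (by
      rw [dist_zero_right, e, le_div_iff₀ hs]
      exact h)]
    exact (unitBump n).nonneg

end Cutoff

/-! ### The Dirichlet form on smooth functions -/

section SmoothFunctions

variable {n : ℕ} {M : Type*} [TopologicalSpace M] [ChartedSpace (EuclideanSpace ℝ (Fin n)) M]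

variable (n M) in
/-- The vector space of smooth functions. -/
def smoothFunctions : Submodule ℝ (M → ℝ) where
  carrier := {f | IsSmooth (n := n) f}
  add_mem' hf hh := ContMDiff.add hf hh
  zero_mem' := contMDiff_const
  smul_mem' c f hf := (ContDiff.contMDiff (contDiff_const_smul c)).comp (f := f) hf

theorem IsSmooth.continuous {f : M → ℝ} (hf : IsSmooth (n := n) f) : Continuous f :=
  ContMDiff.continuous hf

theorem isSmooth_const (c : ℝ) : IsSmooth (n := n) (fun _ : M ↦ c) := contMDiff_const

variable [IsManifold (𝓡 n) ∞ M]

theorem gradInner_add (g : SmoothMetric n M) {f₁ f₂ : M → ℝ} (h₁ : IsSmooth (n := n) f₁)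
    (h₂ : IsSmooth (n := n) f₂) (h : M → ℝ) (m : M) :
    gradInner g (f₁ + f₂) h m = gradInner g f₁ h m + gradInner g f₂ h m := by
  simp only [gradInner_eq, differential]
  rw [mfderiv_add (h₁.mdifferentiableAt m) (h₂.mdifferentiableAt m)]
  rfl

theorem gradInner_smul (g : SmoothMetric n M) (c : ℝ) {f : M → ℝ} (hf : IsSmooth (n := n) f)
    (h : M → ℝ) (m : M) : gradInner g (c • f) h m = c * gradInner g f h m := by
  simp only [gradInner_eq, differential]
  rw [const_smul_mfderiv (hf.mdifferentiableAt m)]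
  rfl

theorem gradInner_const (g : SmoothMetric n M) (c : ℝ) (h : M → ℝ) (m : M) :
    gradInner g (fun _ ↦ c) h m = 0 := by
  simp only [gradInner_eq, differential]
  rw [mfderiv_const]
  rfl

variable [CompactSpace M] [MeasurableSpace M] [BorelSpace M] (g : SmoothMetric n M)
  [IsFiniteMeasure (vol g)]

theorem integrable_of_continuous {f : M → ℝ} (hf : Continuous f) : Integrable f (vol g) := by
  obtain ⟨C, hC⟩ := isCompact_univ.exists_bound_of_continuousOn hf.continuousOn
  exact Integrable.of_bound hf.measurable.aestronglyMeasurable C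
    (Eventually.of_forall fun m ↦ hC m trivial)

theorem memLp_of_continuous {f : M → ℝ} (hf : Continuous f) : MemLp f 2 (vol g) := by
  obtain ⟨C, hC⟩ := isCompact_univ.exists_bound_of_continuousOn hf.continuousOn
  exact MemLp.of_bound hf.measurable.aestronglyMeasurable C
    (Eventually.of_forall fun m ↦ hC m trivial)

theorem integrable_gradInner {f h : M → ℝ} (hf : IsSmooth (n := n) f)
    (hh : IsSmooth (n := n) h) : Integrable (gradInner g f h) (vol g) :=
  integrable_of_continuous g (continuous_gradInner g hf hh)

/-- The inclusion of the smooth functions in `L²`. -/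
def toL2 : smoothFunctions n M →ₗ[ℝ] Lp ℝ 2 (vol g) where
  toFun f := (memLp_of_continuous g (IsSmooth.continuous (n := n) f.2)).toLp
  map_add' _ _ := rfl
  map_smul' _ _ := rfl

theorem coeFn_toL2 (f : smoothFunctions n M) : toL2 g f =ᵐ[vol g] (f : M → ℝ) :=
  MemLp.coeFn_toLp (memLp_of_continuous g (IsSmooth.continuous (n := n) f.2))

/-- The Dirichlet form as a bilinear map. -/
def dirichletBilin : smoothFunctions n M →ₗ[ℝ] smoothFunctions n M →ₗ[ℝ] ℝ :=
  have hadd : ∀ f₁ f₂ h : smoothFunctions n M, dirichletForm g (f₁ + f₂ : M → ℝ) h =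
      dirichletForm g (f₁ : M → ℝ) h + dirichletForm g (f₂ : M → ℝ) h := fun f₁ f₂ h ↦ by
    have := integral_add (integrable_gradInner g f₁.2 h.2) (integrable_gradInner g f₂.2 h.2)
    rw [← integral_congr_ae (Eventually.of_forall fun m ↦ gradInner_add g f₁.2 f₂.2 h m)] at this
    exact this
  have hsmul : ∀ (c : ℝ) (f h : smoothFunctions n M), dirichletForm g (c • f : M → ℝ) h =
      c * dirichletForm g (f : M → ℝ) h := fun c f h ↦ by
    have := integral_const_mul (μ := vol g) c (gradInner g (f : M → ℝ) h)
    rw [← integral_congr_ae (Eventually.of_forall fun m ↦ gradInner_smul g c f.2 h m)] at this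
    exact this
  have hsymm : ∀ f h : M → ℝ, dirichletForm g f h = dirichletForm g h f := fun f h ↦
    integral_congr_ae (Eventually.of_forall fun m ↦ gradInner_symm g f h m)
  LinearMap.mk₂ ℝ (fun f h ↦ dirichletForm g (f : M → ℝ) (h : M → ℝ)) hadd hsmul
    (fun f h₁ h₂ ↦ by
      rw [hsymm, hsymm f, hsymm f]
      exact hadd h₁ h₂ f)
    (fun c f h ↦ by
      rw [hsymm, hsymm f]
      exact hsmul c h f)

theorem dirichletBilin_apply (f h : smoothFunctions n M) :
    dirichletBilin g f h = ∫ m, gradInner g f h m ∂(vol g) := rfl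

end SmoothFunctions

/-! ### The local Poincaré inequality -/

/-- The variance as a double integral. -/
theorem lintegral_lintegral_sq_sub {α : Type*} [MeasurableSpace α] {ν : Measure α}
    [IsFiniteMeasure ν] {f : α → ℝ} (hf : MemLp f 2 ν) :
    ∫⁻ x, ∫⁻ y, ENNReal.ofReal ((f x - f y) ^ 2) ∂ν ∂ν =
      ENNReal.ofReal (2 * (ν.real Set.univ * ∫ x, f x ^ 2 ∂ν - (∫ x, f x ∂ν) ^ 2)) := by
  have h1 : Integrable f ν := hf.integrable one_le_two
  have h2 : Integrable (fun x ↦ f x ^ 2) ν := hf.integrable_sq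
  have hin : ∀ x, Integrable (fun y ↦ (f x - f y) ^ 2) ν := fun x ↦
    ((memLp_const (f x)).sub hf).integrable_sq
  have e1 : ∀ x, ∫ y, (f x - f y) ^ 2 ∂ν =
      ν.real Set.univ * f x ^ 2 - 2 * (∫ y, f y ∂ν) * f x + ∫ y, f y ^ 2 ∂ν := fun x ↦ by
    have : ∀ y, (f x - f y) ^ 2 = (f x ^ 2 - 2 * f x * f y) + f y ^ 2 := fun y ↦ by ring
    simp_rw [this]
    have i1 : Integrable (fun y ↦ f x ^ 2 - 2 * f x * f y) ν :=
      (integrable_const _).sub (h1.const_mul _)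
    rw [integral_add i1 h2, integral_sub (integrable_const _) (h1.const_mul _), integral_const,
      integral_const_mul, smul_eq_mul]
    ring
  have e2 : ∀ x, ∫⁻ y, ENNReal.ofReal ((f x - f y) ^ 2) ∂ν = ENNReal.ofReal
      (ν.real Set.univ * f x ^ 2 - 2 * (∫ y, f y ∂ν) * f x + ∫ y, f y ^ 2 ∂ν) := fun x ↦ by
    rw [← e1, ofReal_integral_eq_lintegral_ofReal (hin x)
      (Eventually.of_forall fun y ↦ sq_nonneg _)]
  simp_rw [e2]
  have i3 : Integrable (fun x ↦ ν.real Set.univ * f x ^ 2 - 2 * (∫ y, f y ∂ν) * f x) ν :=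
    (h2.const_mul _).sub (h1.const_mul _)
  have i4 : Integrable (fun x ↦ ν.real Set.univ * f x ^ 2 - 2 * (∫ y, f y ∂ν) * f x +
      ∫ y, f y ^ 2 ∂ν) ν := i3.add (integrable_const _)
  rw [← ofReal_integral_eq_lintegral_ofReal i4 (Eventually.of_forall fun x ↦ by
      change 0 ≤ ν.real Set.univ * f x ^ 2 - _ * f x + _
      rw [← e1]
      exact integral_nonneg fun y ↦ sq_nonneg _)]
  congr 1
  rw [integral_add i3 (integrable_const _), integral_sub (h2.const_mul _) (h1.const_mul _),
    integral_const, integral_const_mul, integral_const_mul, smul_eq_mul]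
  ring

section LocalPoincare

variable {n : ℕ} {M : Type*} [TopologicalSpace M] [ChartedSpace (EuclideanSpace ℝ (Fin n)) M]
  [IsManifold (𝓡 n) ∞ M]

local notation "E" => EuclideanSpace ℝ (Fin n)
local notation "φ" => extChartAt (𝓡 n)

/-- The closed coordinate ball of radius `r` around `p` lies in the chart, and on it the metric is
between `lam` and `Lam` times the Euclidean one and the volume density is between `c` and `D`. -/
structure IsCoordinateBall (g : SmoothMetric n M) (p : M) (r lam Lam c D : ℝ) : Prop where
  r_pos : 0 < r
  lam_pos : 0 < lam
  Lam_pos : 0 < Lam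
  c_pos : 0 < c
  D_pos : 0 < D
  subset_target : Metric.closedBall (φ p p) r ⊆ (φ p).target
  le_coordForm : ∀ y ∈ Metric.closedBall (φ p p) r, ∀ a, lam * ‖a‖ ^ 2 ≤ coordForm g p y a a
  coordForm_le : ∀ y ∈ Metric.closedBall (φ p p) r, ∀ a, coordForm g p y a a ≤ Lam * ‖a‖ ^ 2
  le_density : ∀ y ∈ Metric.closedBall (φ p p) r, c ≤ √(gramMatrix g p y).det
  density_le : ∀ y ∈ Metric.closedBall (φ p p) r, √(gramMatrix g p y).det ≤ D

theorem exists_isCoordinateBall (g : SmoothMetric n M) (p : M) :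
    ∃ r lam Lam c D, IsCoordinateBall g p r lam Lam c D := by
  obtain ⟨r, hr, lam, hlam, Lam, hLam, ht, h⟩ := exists_coordForm_bounds g p
  have hc := (continuousOn_sqrt_det g p).mono ht
  obtain ⟨c, hc0, h1⟩ := (isCompact_closedBall _ _).exists_forall_le' hc (a := 0)
    fun y hy ↦ sqrt_det_pos g (ht hy)
  obtain ⟨D, h2⟩ := (isCompact_closedBall _ _).bddAbove_image hc
  exact ⟨r, lam, Lam, c, max D 1, hr, hlam, hLam, hc0, by positivity, ht, fun y hy a ↦ (h y hy a).1,
    fun y hy a ↦ (h y hy a).2, h1, fun y hy ↦ (h2 ⟨y, hy, rfl⟩).trans (le_max_left _ _)⟩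

variable [CompactSpace M] [MeasurableSpace M] [BorelSpace M] {g : SmoothMetric n M}
  [IsFiniteMeasure (vol g)]

namespace IsCoordinateBall

variable {p : M} {r lam Lam c D : ℝ} (h : IsCoordinateBall g p r lam Lam c D)
  {K : Set (EuclideanSpace ℝ (Fin n))} {f : M → ℝ}

include h

omit [CompactSpace M] in
theorem lintegral_sq_sub_le (hKb : K ⊆ Metric.closedBall (φ p p) r) (hKm : MeasurableSet K)
    (hfm : Measurable f) :
    ∫⁻ m in (φ p).source ∩ φ p ⁻¹' K, ∫⁻ m' in (φ p).source ∩ φ p ⁻¹' K,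
      ENNReal.ofReal ((f m - f m') ^ 2) ∂(vol g) ∂(vol g) ≤
      ENNReal.ofReal D * (ENNReal.ofReal D * ∫⁻ x in K, ∫⁻ y in K,
        ENNReal.ofReal (((f ∘ (φ p).symm) x - (f ∘ (φ p).symm) y) ^ 2)) := by
  have hKt : K ⊆ (φ p).target := hKb.trans h.subset_target
  have hmeas : Measurable fun z : M × M ↦ ENNReal.ofReal ((f z.1 - f z.2) ^ 2) :=
    (((hfm.comp measurable_fst).sub (hfm.comp measurable_snd)).pow_const 2).ennreal_ofReal
  have hm1 : Measurable fun m ↦ ∫⁻ m' in (φ p).source ∩ φ p ⁻¹' K,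
      ENNReal.ofReal ((f m - f m') ^ 2) ∂(vol g) := hmeas.lintegral_prod_right'
  have hm2 : ∀ t, Measurable fun m' ↦ ENNReal.ofReal ((t - f m') ^ 2) := fun t ↦
    ((measurable_const.sub hfm).pow_const 2).ennreal_ofReal
  rw [setLIntegral_vol g p hKm hKt hm1, ← lintegral_const_mul' _ _ ENNReal.ofReal_ne_top,
    ← lintegral_const_mul' _ _ ENNReal.ofReal_ne_top]
  refine setLIntegral_mono' hKm fun x hx ↦ ?_
  rw [setLIntegral_vol g p hKm hKt (hm2 _)]
  refine mul_le_mul' (ENNReal.ofReal_le_ofReal (h.density_le x (hKb hx))) ?_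
  rw [← lintegral_const_mul' _ _ ENNReal.ofReal_ne_top]
  refine setLIntegral_mono' hKm fun y hy ↦ ?_
  exact mul_le_mul' (ENNReal.ofReal_le_ofReal (h.density_le y (hKb hy))) le_rfl

omit [CompactSpace M] in
theorem volume_le (hKb : K ⊆ Metric.closedBall (φ p p) r) (hKm : MeasurableSet K) :
    volume K ≤ ENNReal.ofReal (c⁻¹ * (vol g).real ((φ p).source ∩ φ p ⁻¹' K)) := by
  have hc := h.c_pos
  have h1 : ENNReal.ofReal c * volume K ≤ vol g ((φ p).source ∩ φ p ⁻¹' K) := by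
    rw [vol_chart g p hKm (hKb.trans h.subset_target), ← setLIntegral_const]
    exact setLIntegral_mono' hKm fun y hy ↦ ENNReal.ofReal_le_ofReal (h.le_density y (hKb hy))
  rw [ENNReal.ofReal_mul (by positivity), ofReal_measureReal]
  calc volume K = ENNReal.ofReal c⁻¹ * (ENNReal.ofReal c * volume K) := by
        rw [← mul_assoc, ← ENNReal.ofReal_mul (by positivity),
          inv_mul_cancel₀ hc.ne', ENNReal.ofReal_one, one_mul]
    _ ≤ _ := by gcongr

theorem lintegral_fderiv_le (hKb : K ⊆ Metric.closedBall (φ p p) r) (hKm : MeasurableSet K)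
    (hf : IsSmooth (n := n) f) :
    ∫⁻ x in K, ENNReal.ofReal (‖fderiv ℝ (f ∘ (φ p).symm) x‖ ^ 2) ≤ ENNReal.ofReal
      (Lam * c⁻¹ * ∫ m in (φ p).source ∩ φ p ⁻¹' K, gradInner g f f m ∂(vol g)) := by
  have hKt : K ⊆ (φ p).target := hKb.trans h.subset_target
  have hc := h.c_pos
  have hL := h.Lam_pos
  rw [ENNReal.ofReal_mul (by positivity), ofReal_integral_eq_lintegral_ofReal
    (integrable_gradInner g hf hf).integrableOn
    (Eventually.of_forall fun m ↦ gradInner_self_nonneg g f m),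
    setLIntegral_vol g p hKm hKt (continuous_gradInner g hf hf).measurable.ennreal_ofReal,
    ← lintegral_const_mul' _ _ ENNReal.ofReal_ne_top]
  refine setLIntegral_mono' hKm fun x hx ↦ ?_
  rw [← ENNReal.ofReal_mul (Real.sqrt_nonneg _), ← ENNReal.ofReal_mul (by positivity)]
  refine ENNReal.ofReal_le_ofReal ?_
  have h2 := norm_fderiv_sq_le_of_coordForm_le g (hKt hx) (hf.mdifferentiableAt _) h.Lam_pos
    (h.coordForm_le x (hKb hx))
  have h3 := h.le_density x (hKb hx)
  have h4 := gradInner_self_nonneg g f ((φ p).symm x)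
  calc ‖fderiv ℝ (f ∘ (φ p).symm) x‖ ^ 2 ≤ Lam * gradInner g f f ((φ p).symm x) := h2
    _ = Lam * c⁻¹ * (c * gradInner g f f ((φ p).symm x)) := by field_simp
    _ ≤ _ := by gcongr

/-- The Poincaré inequality on a convex subset of a coordinate ball. -/
theorem poincare (hKb : K ⊆ Metric.closedBall (φ p p) r)
    (hK : Convex ℝ K) (hKm : MeasurableSet K) {d : ℝ} (hd : ∀ x ∈ K, ∀ y ∈ K, ‖x - y‖ ≤ d)
    (hf : IsSmooth (n := n) f) :
    ∫ m in (φ p).source ∩ φ p ⁻¹' K, f m ^ 2 ∂(vol g) ≤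
      2 ^ n * D ^ 2 * c⁻¹ ^ 2 * Lam * d ^ 2 *
        ∫ m in (φ p).source ∩ φ p ⁻¹' K, gradInner g f f m ∂(vol g) +
      (∫ m in (φ p).source ∩ φ p ⁻¹' K, f m ∂(vol g)) ^ 2 /
        (vol g).real ((φ p).source ∩ φ p ⁻¹' K) := by
  have hc := h.c_pos
  have hD := h.D_pos
  have hL := h.Lam_pos
  have hfm : Measurable f := hf.continuous.measurable
  have s1 := h.lintegral_sq_sub_le hKb hKm hfm
  have s2 := h.volume_le hKb hKm
  have s3 := h.lintegral_fderiv_le hKb hKm hf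
  have s4 := poincare_convex (isOpen_extChartAt_target p) ((hf.contDiffOn p).of_le (by simp))
    hK hKm (hKb.trans h.subset_target) hd
  set A := (φ p).source ∩ φ p ⁻¹' K with hA
  set I := ∫ m in A, gradInner g f f m ∂(vol g) with hI
  have hI0 : 0 ≤ I := integral_nonneg fun m ↦ gradInner_self_nonneg g f m
  set B := D * (D * (d ^ 2 * (2 ^ n * (c⁻¹ * (vol g).real A) * (Lam * c⁻¹ * I)))) with hB
  have s5 : ∫⁻ m in A, ∫⁻ m' in A, ENNReal.ofReal ((f m - f m') ^ 2) ∂(vol g) ∂(vol g) ≤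
      ENNReal.ofReal B := by
    refine s1.trans ?_
    rw [hB, ENNReal.ofReal_mul hD.le, ENNReal.ofReal_mul hD.le, ENNReal.ofReal_mul (sq_nonneg _),
      ENNReal.ofReal_mul (by positivity), ENNReal.ofReal_mul (by positivity),
      ENNReal.ofReal_pow zero_le_two, ENNReal.ofReal_ofNat]
    refine mul_le_mul' le_rfl (mul_le_mul' le_rfl (s4.trans ?_))
    exact mul_le_mul' le_rfl (mul_le_mul' (mul_le_mul' le_rfl s2) s3)
  rw [lintegral_lintegral_sq_sub ((memLp_of_continuous g hf.continuous).restrict A)] at s5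
  have hB0 : 0 ≤ B := by positivity
  rw [ENNReal.ofReal_le_ofReal_iff hB0, measureReal_restrict_apply_univ] at s5
  -- For a null set both sides vanish, the quotient by its volume being zero.
  rcases (measureReal_nonneg (μ := vol g) (s := A)).eq_or_lt with h0 | h0
  · have : (vol g).restrict A = 0 := by
      rw [Measure.restrict_eq_zero]
      exact (measureReal_eq_zero_iff).1 h0.symm
    simp [hI, this]
  · have e : ∀ a b v : ℝ, 0 < v → 2 * (v * a - b ^ 2) ≤ B → a ≤ B / v + b ^ 2 / v := by
      intro a b v hv hle
      rw [← add_div, le_div_iff₀ hv]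
      linarith
    refine (e _ _ _ h0 s5).trans_eq ?_
    congr 1
    rw [hB]
    field_simp

end IsCoordinateBall

end LocalPoincare

/-! ### Compactness and connectedness of the Dirichlet form -/

section Compactness

open scoped InnerProductSpace

theorem norm_sq_eq_integral {α : Type*} [MeasurableSpace α] {μ : Measure α} (u : Lp ℝ 2 μ) :
    ‖u‖ ^ 2 = ∫ x, u x ^ 2 ∂μ := by
  rw [← real_inner_self_eq_norm_sq, L2.inner_def]
  refine integral_congr_ae (Eventually.of_forall fun x ↦ ?_)
  simp [sq]

theorem sum_le_card_mul_sum_image {J H : Type*} [DecidableEq H] (s : Finset J) (e : J → H)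
    (q : H → ℝ) (hq : ∀ x, 0 ≤ q x) : ∑ i ∈ s, q (e i) ≤ s.card * ∑ x ∈ s.image e, q x := by
  rw [← nsmul_eq_mul]
  exact Finset.sum_le_card_nsmul _ _ _ fun i hi ↦
    Finset.single_le_sum (fun x _ ↦ hq x) (Finset.mem_image_of_mem e hi)

variable {n : ℕ} {M : Type*} [TopologicalSpace M] [ChartedSpace (EuclideanSpace ℝ (Fin n)) M]
  [IsManifold (𝓡 n) ∞ M] [CompactSpace M] [MeasurableSpace M] [BorelSpace M]
  {g : SmoothMetric n M} [IsFiniteMeasure (vol g)]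

local notation "E" => EuclideanSpace ℝ (Fin n)
local notation "φ" => extChartAt (𝓡 n)

theorem setIntegral_toL2_sq (f : smoothFunctions n M) (A : Set M) :
    ∫ m in A, toL2 g f m ^ 2 ∂(vol g) = ∫ m in A, (f : M → ℝ) m ^ 2 ∂(vol g) :=
  integral_congr_ae (ae_restrict_of_ae ((coeFn_toL2 g f).fun_comp (· ^ 2)))

theorem setIntegral_toL2 (f : smoothFunctions n M) (A : Set M) :
    ∫ m in A, toL2 g f m ∂(vol g) = ∫ m in A, (f : M → ℝ) m ∂(vol g) :=
  integral_congr_ae (ae_restrict_of_ae (coeFn_toL2 g f))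

theorem norm_toL2_sq (f : smoothFunctions n M) :
    ‖toL2 g f‖ ^ 2 = ∫ m, (f : M → ℝ) m ^ 2 ∂(vol g) := by
  rw [norm_sq_eq_integral, ← setIntegral_univ, setIntegral_toL2_sq, setIntegral_univ]

theorem setIntegral_gradInner_le (f : smoothFunctions n M) (A : Set M) :
    ∫ m in A, gradInner g f f m ∂(vol g) ≤ dirichletBilin g f f :=
  setIntegral_le_integral (integrable_gradInner g f.2 f.2)
    (Eventually.of_forall fun m ↦ gradInner_self_nonneg g f m)

variable (n) in
/-- The closed coordinate ball, as a subset of `M`. -/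
def coordBall (p : M) (r : ℝ) : Set M := (φ p).source ∩ φ p ⁻¹' Metric.closedBall (φ p p) r

omit [IsManifold (𝓡 n) ∞ M] [CompactSpace M] [MeasurableSpace M] [BorelSpace M] in
theorem coordBall_mem_nhds (p : M) {r : ℝ} (hr : 0 < r) : coordBall n p r ∈ 𝓝 p :=
  inter_mem (extChartAt_source_mem_nhds p)
    ((continuousAt_extChartAt p).preimage_mem_nhds (Metric.closedBall_mem_nhds _ hr))

omit [IsManifold (𝓡 n) ∞ M] [CompactSpace M] in
theorem measurableSet_coordBall (p : M) (r : ℝ) : MeasurableSet (coordBall n p r) :=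
  measurableSet_source_inter p measurableSet_closedBall

/-- A coordinate ball is cut into finitely many convex pieces of small diameter, on each of which
the Poincaré inequality holds. -/
theorem IsCoordinateBall.exists_ehrling {p : M} {r lam Lam c D : ℝ}
    (h : IsCoordinateBall g p r lam Lam c D) {ε : ℝ} (hε : 0 < ε) :
    ∃ (C : ℝ) (s : Finset (Lp ℝ 2 (vol g))), 0 ≤ C ∧ ∀ f : smoothFunctions n M,
      ∫ m in coordBall n p r, (f : M → ℝ) m ^ 2 ∂(vol g) ≤
        ε * dirichletBilin g f f + C * ∑ e ∈ s, ⟪e, toL2 g f⟫_ℝ ^ 2 := by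
  classical
  obtain ⟨d, hd, hdε⟩ : ∃ d > 0, 2 ^ n * D ^ 2 * c⁻¹ ^ 2 * Lam * d ^ 2 < ε := by
    have h1 : Tendsto (fun d : ℝ ↦ 2 ^ n * D ^ 2 * c⁻¹ ^ 2 * Lam * d ^ 2) (𝓝[>] 0) (𝓝 0) := by
      have : Tendsto (fun d : ℝ ↦ 2 ^ n * D ^ 2 * c⁻¹ ^ 2 * Lam * d ^ 2) (𝓝 0)
          (𝓝 (2 ^ n * D ^ 2 * c⁻¹ ^ 2 * Lam * 0 ^ 2)) := (tendsto_id.pow 2).const_mul _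
      rw [zero_pow two_ne_zero, mul_zero] at this
      exact this.mono_left nhdsWithin_le_nhds
    obtain ⟨d, h2, h3⟩ := ((h1.eventually (gt_mem_nhds hε)).and self_mem_nhdsWithin).exists
    exact ⟨d, h3, h2⟩
  obtain ⟨s, K, hKu, hKc, hKm, hKd, hKdiam⟩ := exists_convex_partition
    (convex_closedBall (φ p p) r) measurableSet_closedBall Metric.isBounded_closedBall hd
  let A : (Fin n → ℤ) → Set M := fun i ↦ (φ p).source ∩ φ p ⁻¹' K i
  have hAm : ∀ i, MeasurableSet (A i) := fun i ↦ measurableSet_source_inter p (hKm i)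
  have hAu : coordBall n p r = ⋃ i ∈ s, A i := by
    rw [coordBall, hKu]
    simp only [A, Set.preimage_iUnion₂, Set.inter_iUnion₂]
  have hAd : (s : Set (Fin n → ℤ)).Pairwise (Function.onFun Disjoint A) := fun i _ j _ hij ↦
    Set.disjoint_left.2 fun m hm hm' ↦ Set.disjoint_left.1 (hKd hij) hm.2 hm'.2
  -- The functionals are the normalized mean values over the pieces.
  let e : (Fin n → ℤ) → Lp ℝ 2 (vol g) := fun i ↦
    (√((vol g).real (A i)))⁻¹ • indicatorConstLp 2 (hAm i) (measure_ne_top _ _) (1 : ℝ)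
  refine ⟨s.card, s.image e, Nat.cast_nonneg _, fun f ↦ ?_⟩
  have hsum : ∀ F : M → ℝ, Integrable F (vol g) →
      ∫ m in coordBall n p r, F m ∂(vol g) = ∑ i ∈ s, ∫ m in A i, F m ∂(vol g) := fun F hF ↦ by
    rw [hAu, integral_biUnion_finset s (fun i _ ↦ hAm i) hAd fun i _ ↦ hF.integrableOn]
  have he : ∀ i, ⟪e i, toL2 g f⟫_ℝ ^ 2 =
      (∫ m in A i, (f : M → ℝ) m ∂(vol g)) ^ 2 / (vol g).real (A i) := fun i ↦ by
    rw [real_inner_smul_left, L2.inner_indicatorConstLp_one, setIntegral_toL2, mul_pow, inv_pow,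
      Real.sq_sqrt measureReal_nonneg, inv_mul_eq_div]
  have hf2 : Integrable (fun m ↦ (f : M → ℝ) m ^ 2) (vol g) :=
    integrable_of_continuous g (f.2.continuous.pow 2)
  rw [hsum _ hf2]
  calc ∑ i ∈ s, ∫ m in A i, (f : M → ℝ) m ^ 2 ∂(vol g)
      ≤ ∑ i ∈ s, (ε * ∫ m in A i, gradInner g f f m ∂(vol g) + ⟪e i, toL2 g f⟫_ℝ ^ 2) := by
        refine Finset.sum_le_sum fun i hi ↦ ?_
        have hKb : K i ⊆ Metric.closedBall (φ p p) r := by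
          rw [hKu]
          exact Set.subset_biUnion_of_mem (u := K) hi
        rw [he]
        refine (h.poincare hKb (hKc i) (hKm i) (hKdiam i) f.2).trans ?_
        have : 0 ≤ ∫ m in A i, gradInner g f f m ∂(vol g) :=
          integral_nonneg fun m ↦ gradInner_self_nonneg g f m
        gcongr
    _ = ε * ∫ m in coordBall n p r, gradInner g f f m ∂(vol g) +
          ∑ i ∈ s, ⟪e i, toL2 g f⟫_ℝ ^ 2 := by
        rw [Finset.sum_add_distrib, ← Finset.mul_sum, hsum _ (integrable_gradInner g f.2 f.2)]
    _ ≤ _ := by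
        gcongr
        · exact setIntegral_gradInner_le f _
        · exact sum_le_card_mul_sum_image s e (fun x ↦ ⟪x, toL2 g f⟫_ℝ ^ 2) fun x ↦ sq_nonneg _

/-- A limit of smooth functions of vanishing energy is constant on coordinate balls. -/
theorem IsCoordinateBall.exists_ae_eq_const {p : M} {r lam Lam c D : ℝ}
    (h : IsCoordinateBall g p r lam Lam c D) {f : ℕ → smoothFunctions n M} {w : Lp ℝ 2 (vol g)}
    (hw : Tendsto (fun j ↦ toL2 g (f j)) atTop (𝓝 w))
    (hD : Tendsto (fun j ↦ dirichletBilin g (f j) (f j)) atTop (𝓝 0)) :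
    ∃ a : ℝ, ∀ᵐ m ∂((vol g).restrict (coordBall n p r)), w m = a := by
  set A := coordBall n p r with hA
  have hAm : MeasurableSet A := measurableSet_coordBall p r
  have hres : ∀ u : Lp ℝ 2 (vol g), ‖LpToLpRestrictCLM M ℝ ℝ (vol g) 2 A u‖ ^ 2 =
      ∫ m in A, u m ^ 2 ∂(vol g) := fun u ↦ by
    rw [norm_sq_eq_integral]
    exact integral_congr_ae ((LpToLpRestrictCLM_coeFn ℝ A u).fun_comp (· ^ 2))
  have t1 : Tendsto (fun j ↦ ∫ m in A, (f j : M → ℝ) m ^ 2 ∂(vol g)) atTop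
      (𝓝 (∫ m in A, w m ^ 2 ∂(vol g))) := by
    have := (((LpToLpRestrictCLM M ℝ ℝ (vol g) 2 A).continuous.tendsto w).comp hw).norm.pow 2
    simp only [Function.comp, hres, setIntegral_toL2_sq] at this
    exact this
  have t2 : Tendsto (fun j ↦ ∫ m in A, (f j : M → ℝ) m ∂(vol g)) atTop
      (𝓝 (∫ m in A, w m ∂(vol g))) := by
    have := tendsto_const_nhds (x := indicatorConstLp 2 hAm (measure_ne_top (vol g) A) (1 : ℝ))
      |>.inner (𝕜 := ℝ) hw
    simp only [L2.inner_indicatorConstLp_one, setIntegral_toL2] at this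
    exact this
  -- In the limit, the Poincaré inequality is the case of equality in Cauchy–Schwarz.
  have hlim : ∫ m in A, w m ^ 2 ∂(vol g) ≤
      (∫ m in A, w m ∂(vol g)) ^ 2 / (vol g).real A := by
    have t3 := (hD.const_mul (2 ^ n * D ^ 2 * c⁻¹ ^ 2 * Lam * (2 * r) ^ 2)).add
      ((t2.pow 2).div_const ((vol g).real A))
    rw [mul_zero, zero_add] at t3
    refine le_of_tendsto_of_tendsto' t1 t3 fun j ↦ ?_
    refine (h.poincare subset_rfl (convex_closedBall _ _) measurableSet_closedBall
      (d := 2 * r) ?_ (f j).2).trans ?_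
    · intro x hx y hy
      rw [← dist_eq_norm]
      have := dist_triangle_right x y (φ p p)
      rw [Metric.mem_closedBall] at hx hy
      linarith
    · have := h.c_pos
      have := h.Lam_pos
      refine add_le_add ?_ le_rfl
      gcongr
      exact setIntegral_gradInner_le _ _
  have hv : (vol g).real A ≠ 0 := by
    have h1 := vol_pos_of_isOpen g isOpen_interior
      ⟨p, mem_interior_iff_mem_nhds.2 (coordBall_mem_nhds (n := n) p h.r_pos)⟩
    have h2 := h1.trans_le (measure_mono (interior_subset (s := A)))
    exact (ENNReal.toReal_pos h2.ne' (measure_ne_top _ _)).ne'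
  have hwL : MemLp w 2 ((vol g).restrict A) := (Lp.memLp w).restrict A
  set a := (∫ m in A, w m ∂(vol g)) / (vol g).real A with ha
  have i1 : Integrable (fun m ↦ w m ^ 2) ((vol g).restrict A) := hwL.integrable_sq
  have i2 : Integrable (fun m ↦ 2 * a * w m) ((vol g).restrict A) :=
    (hwL.integrable one_le_two).const_mul _
  have i3 : Integrable (fun m ↦ w m ^ 2 - 2 * a * w m) ((vol g).restrict A) := i1.sub i2
  have hle : ∫ m in A, (w m - a) ^ 2 ∂(vol g) ≤ 0 := by
    have e1 : ∀ m, (w m - a) ^ 2 = w m ^ 2 - 2 * a * w m + a ^ 2 := fun m ↦ by ring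
    simp_rw [e1]
    rw [integral_add i3 (integrable_const _), integral_sub i1 i2, integral_const_mul,
      integral_const, measureReal_restrict_apply_univ, smul_eq_mul]
    refine (add_le_add_left (sub_le_sub_right hlim _) _).trans_eq ?_
    rw [ha]
    field_simp
    ring
  refine ⟨a, ?_⟩
  have h0 := (integral_eq_zero_iff_of_nonneg (fun m ↦ sq_nonneg (w m - a))
    (hwL.sub (memLp_const a)).integrable_sq).1
    (hle.antisymm (integral_nonneg fun m ↦ sq_nonneg _))
  filter_upwards [h0] with m hm
  simpa [sub_eq_zero] using hm

variable (n M) in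
/-- The constant function `1`. -/
def oneFunction : smoothFunctions n M := ⟨fun _ ↦ 1, isSmooth_const 1⟩

/-- A limit of smooth functions of vanishing energy on a connected manifold is constant. -/
theorem exists_ae_eq_const [PreconnectedSpace M] {f : ℕ → smoothFunctions n M}
    {w : Lp ℝ 2 (vol g)} (hw : Tendsto (fun j ↦ toL2 g (f j)) atTop (𝓝 w))
    (hD : Tendsto (fun j ↦ dirichletBilin g (f j) (f j)) atTop (𝓝 0)) :
    ∃ a : ℝ, ∀ᵐ m ∂(vol g), w m = a := by
  have hloc : ∀ p : M, ∃ U ∈ 𝓝 p, ∃ a : ℝ, ∀ᵐ m ∂((vol g).restrict U), w m = a := fun p ↦ by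
    obtain ⟨r, lam, Lam, c, D, h⟩ := exists_isCoordinateBall g p
    exact ⟨_, coordBall_mem_nhds p h.r_pos, h.exists_ae_eq_const hw hD⟩
  choose U hU a ha using hloc
  have hconst : IsLocallyConstant a := by
    refine (IsLocallyConstant.iff_eventually_eq a).2 fun p ↦ ?_
    filter_upwards [eventually_mem_nhds_iff.2 (hU p)] with q hq
    have h1 := vol_pos_of_isOpen g isOpen_interior
      ⟨q, mem_interior_iff_mem_nhds.2 (inter_mem hq (hU q))⟩
    have h2 : ∀ᵐ m ∂((vol g).restrict (interior (U p ∩ U q))), a q = a p := by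
      filter_upwards [ae_restrict_of_ae_restrict_of_subset
        (interior_subset.trans Set.inter_subset_left) (ha p),
        ae_restrict_of_ae_restrict_of_subset
        (interior_subset.trans Set.inter_subset_right) (ha q)] with m h3 h4
      rw [← h3, ← h4]
    by_contra hne
    simp only [hne, ae_iff, not_false_eq_true, Set.ofPred_true, Measure.restrict_apply_univ] at h2
    exact h1.ne' (by simpa using h2)
  obtain ⟨t, -, ht⟩ := isCompact_univ.elim_nhds_subcover U fun p _ ↦ hU p
  rcases isEmpty_or_nonempty M with hM | ⟨⟨p⟩⟩
  · exact ⟨0, Eventually.of_forall fun m ↦ (hM.false m).elim⟩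
  refine ⟨a p, ?_⟩
  have h1 := (ae_restrict_biUnion_finset_iff (μ := vol g) U t fun m ↦ w m = a p).2 fun q _ ↦ by
    rw [hconst.apply_eq_of_preconnectedSpace p q]
    exact ha q
  rwa [Set.univ_subset_iff.1 ht, Measure.restrict_univ] at h1

/-- The Ehrling inequality on `M`, which is covered by finitely many coordinate balls. -/
theorem exists_ehrling {ε : ℝ} (hε : 0 < ε) :
    ∃ (C : ℝ) (s : Finset (Lp ℝ 2 (vol g))), 0 ≤ C ∧ ∀ f : smoothFunctions n M,
      ‖toL2 g f‖ ^ 2 ≤ ε * dirichletBilin g f f + C * ∑ e ∈ s, ⟪e, toL2 g f⟫_ℝ ^ 2 := by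
  classical
  choose r lam Lam c D h using exists_isCoordinateBall g
  obtain ⟨t, -, ht⟩ := isCompact_univ.elim_nhds_subcover (fun p ↦ coordBall n p (r p))
    fun p _ ↦ coordBall_mem_nhds p (h p).r_pos
  have hδ : 0 < ε / (t.card + 1) := by positivity
  choose C s hC hs using fun p ↦ (h p).exists_ehrling hδ
  refine ⟨∑ p ∈ t, C p, t.biUnion s, Finset.sum_nonneg fun p _ ↦ hC p, fun f ↦ ?_⟩
  have hf2 : Integrable (fun m ↦ (f : M → ℝ) m ^ 2) (vol g) :=
    integrable_of_continuous g (f.2.continuous.pow 2)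
  have hD0 : 0 ≤ dirichletBilin g f f := integral_nonneg fun m ↦ gradInner_self_nonneg g f m
  calc ‖toL2 g f‖ ^ 2 = ∫ m, (f : M → ℝ) m ^ 2 ∂(vol g) := norm_toL2_sq f
    _ ≤ ∫ m, ∑ p ∈ t, (coordBall n p (r p)).indicator (fun m ↦ (f : M → ℝ) m ^ 2) m ∂(vol g) := by
        refine integral_mono hf2 (integrable_finsetSum _ fun p _ ↦
          hf2.indicator (measurableSet_coordBall _ _)) fun m ↦ ?_
        obtain ⟨p, hp, hm⟩ := Set.mem_iUnion₂.1 (ht (Set.mem_univ m))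
        have h1 := Finset.single_le_sum (f := fun p ↦
          (coordBall n p (r p)).indicator (fun m ↦ (f : M → ℝ) m ^ 2) m)
          (fun q _ ↦ Set.indicator_nonneg (fun m _ ↦ sq_nonneg _) m) hp
        simp only [Set.indicator_of_mem hm] at h1
        exact h1
    _ = ∑ p ∈ t, ∫ m in coordBall n p (r p), (f : M → ℝ) m ^ 2 ∂(vol g) := by
        rw [integral_finsetSum _ fun p _ ↦ hf2.indicator (measurableSet_coordBall _ _)]
        exact Finset.sum_congr rfl fun p _ ↦ integral_indicator (measurableSet_coordBall _ _)
    _ ≤ ∑ p ∈ t, (ε / (t.card + 1) * dirichletBilin g f f +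
          C p * ∑ e ∈ t.biUnion s, ⟪e, toL2 g f⟫_ℝ ^ 2) := by
        refine Finset.sum_le_sum fun p hp ↦ (hs p f).trans ?_
        have := hC p
        gcongr
        exact Finset.subset_biUnion_of_mem s hp
    _ = t.card * (ε / (t.card + 1)) * dirichletBilin g f f +
          (∑ p ∈ t, C p) * ∑ e ∈ t.biUnion s, ⟪e, toL2 g f⟫_ℝ ^ 2 := by
        rw [Finset.sum_add_distrib, Finset.sum_const, nsmul_eq_mul, ← Finset.sum_mul, mul_assoc]
    _ ≤ _ := by
        gcongr
        rw [mul_div_assoc', div_le_iff₀ (by positivity)]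
        nlinarith

end Compactness

/-! ### The first eigenvalue -/

section FirstEigenvalue

open scoped InnerProductSpace

variable {n : ℕ} {M : Type*} [TopologicalSpace M] [ChartedSpace (EuclideanSpace ℝ (Fin n)) M]
  [IsManifold (𝓡 n) ∞ M] [CompactSpace M] [MeasurableSpace M] [BorelSpace M]
  {g : SmoothMetric n M} [IsFiniteMeasure (vol g)]

local notation "E" => EuclideanSpace ℝ (Fin n)
local notation "φ" => extChartAt (𝓡 n)

theorem inner_one_toL2 (f : smoothFunctions n M) :
    ⟪toL2 g (oneFunction n M), toL2 g f⟫_ℝ = ∫ m, (f : M → ℝ) m ∂(vol g) := by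
  rw [L2.inner_def]
  refine integral_congr_ae ?_
  filter_upwards [coeFn_toL2 g f, coeFn_toL2 g (oneFunction n M)] with m h1 h2
  rw [h1, h2]
  simp [oneFunction]

omit [CompactSpace M] [IsFiniteMeasure (vol g)] in
theorem ae_const_eq_of_isOpen {f : M → ℝ} {a b : ℝ} (hf : ∀ᵐ m ∂(vol g), f m = a) {U : Set M}
    (hU : IsOpen U) (hne : U.Nonempty) (hfU : ∀ m ∈ U, f m = b) : a = b := by
  by_contra hab
  refine (vol_pos_of_isOpen g hU hne).ne' (measure_mono_null (fun m hm ↦ ?_) hf)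
  intro h
  exact hab (h.symm.trans (hfU m hm))

omit [CompactSpace M] in
/-- In positive dimension, there are smooth functions that are not almost everywhere constant. -/
theorem exists_nonconst [T2Space M] [Nonempty M] (hn : 0 < n) (g : SmoothMetric n M)
    [IsFiniteMeasure (vol g)] :
    ∃ f : smoothFunctions n M, ∀ a : ℝ, ¬ ∀ᵐ m ∂(vol g), (f : M → ℝ) m = a := by
  obtain ⟨p⟩ := ‹Nonempty M›
  obtain ⟨r, lam, Lam, c, D, h⟩ := exists_isCoordinateBall g p
  have hr := h.r_pos
  refine ⟨⟨chartBump p (φ p p) (r / 4), isSmooth_chartBump (by positivity)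
    ((Metric.closedBall_subset_closedBall (by linarith)).trans h.subset_target)⟩, fun a ha ↦ ?_⟩
  have hopen : ∀ {K : Set E}, IsOpen K → IsOpen ((φ p).source ∩ φ p ⁻¹' K) := fun hK ↦
    (continuousOn_extChartAt p).isOpen_inter_preimage (isOpen_extChartAt_source p) hK
  have h1 : a = 1 := by
    refine ae_const_eq_of_isOpen ha (hopen (Metric.isOpen_ball (x := φ p p) (ε := r / 4)))
      ⟨p, mem_extChartAt_source p, Metric.mem_ball_self (by positivity)⟩ fun m hm ↦ ?_
    exact chartBump_eq_one (by positivity) hm.1 (Metric.mem_ball.1 hm.2).le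
  have h0 : a = 0 := by
    let v : E := φ p p + EuclideanSpace.single ⟨0, hn⟩ (3 * r / 4)
    have hv : dist v (φ p p) = 3 * r / 4 := by
      simp only [v, dist_self_add_left, PiLp.norm_single]
      exact Real.norm_of_nonneg (by positivity)
    have hvt : v ∈ (φ p).target := h.subset_target (by
      rw [Metric.mem_closedBall, hv]
      linarith)
    refine ae_const_eq_of_isOpen ha (hopen (K := {y | r / 2 < dist y (φ p p)})
      (isOpen_lt continuous_const (by fun_prop)))
      ⟨(φ p).symm v, (φ p).map_target hvt, ?_⟩ fun m hm ↦ ?_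
    · simp only [Set.mem_preimage, (φ p).right_inv hvt, Set.mem_ofPred_eq, hv]
      linarith
    · refine chartBump_eq_zero (by positivity) fun h' ↦ ?_
      have h2 : r / 2 < dist (φ p m) (φ p p) := hm.2
      linarith [h'.2]
  exact one_ne_zero (h1.symm.trans h0)

/-- Rellich compactness and the connectedness of `M`, for the Dirichlet form of `g`. -/
theorem isCompactForm [T2Space M] [ConnectedSpace M] (hn : 0 < n) (g : SmoothMetric n M)
    [IsFiniteMeasure (vol g)] :
    IsCompactForm (toL2 g) (dirichletBilin g) (oneFunction n M) where
  symm f h := integral_congr_ae (Eventually.of_forall fun m ↦ gradInner_symm g f h m)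
  nonneg f := integral_nonneg fun m ↦ gradInner_self_nonneg g f m
  one_left f := by
    rw [dirichletBilin_apply]
    simp only [oneFunction, gradInner_const, integral_zero]
  compact ε hε := exists_ehrling hε
  connected f w hw hD := by
    obtain ⟨a, ha⟩ := exists_ae_eq_const hw hD
    refine ⟨a, Lp.ext ?_⟩
    filter_upwards [ha, coeFn_toL2 g (oneFunction n M),
      Lp.coeFn_smul a (toL2 g (oneFunction n M))] with m h1 h2 h3
    rw [h1, h3, Pi.smul_apply, h2]
    simp [oneFunction]
  one_ne_zero h0 := by
    have h1 : ∀ᵐ m ∂(vol g), (oneFunction n M : M → ℝ) m = 0 := by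
      have := coeFn_toL2 g (oneFunction n M)
      rw [h0] at this
      filter_upwards [this, Lp.coeFn_zero ℝ 2 (vol g)] with m h1 h2
      rw [← h1, h2]
      rfl
    exact zero_ne_one (ae_const_eq_of_isOpen h1 isOpen_univ Set.univ_nonempty fun _ _ ↦ rfl)
  exists_nonconst := by
    obtain ⟨f, hf⟩ := exists_nonconst hn g
    have hv : (vol g).real Set.univ ≠ 0 :=
      (ENNReal.toReal_pos (vol_pos_of_isOpen g isOpen_univ Set.univ_nonempty).ne'
        (measure_ne_top _ _)).ne'
    set a := (∫ m, (f : M → ℝ) m ∂(vol g)) / (vol g).real Set.univ with ha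
    refine ⟨f - a • oneFunction n M, ?_, fun h0 ↦ hf a ?_⟩
    · rw [map_sub, map_smul, inner_sub_right, inner_smul_right, inner_one_toL2, inner_one_toL2]
      simp only [oneFunction, integral_const, smul_eq_mul, mul_one]
      rw [ha]
      field_simp
      ring
    · have := coeFn_toL2 g (f - a • oneFunction n M)
      rw [h0] at this
      filter_upwards [this, Lp.coeFn_zero ℝ 2 (vol g)] with m h1 h2
      rw [h2] at h1
      have h3 : (0 : ℝ) = (f : M → ℝ) m - a * 1 := h1
      linarith

/-- The eigenvalues of the Laplacian are those of the Dirichlet form on the smooth functions. -/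
theorem isLaplaceEigenvalue_iff (g : SmoothMetric n M) [IsFiniteMeasure (vol g)] (lam : ℝ) :
    IsLaplaceEigenvalue g lam ↔ ∃ w f, IsFormEigenvector (toL2 g) (dirichletBilin g) lam w f := by
  have hinner : ∀ (w : Lp ℝ 2 (vol g)) (ψ : smoothFunctions n M),
      ⟪w, toL2 g ψ⟫_ℝ = ∫ m, w m * (ψ : M → ℝ) m ∂(vol g) := fun w ψ ↦ by
    rw [L2.inner_def]
    refine integral_congr_ae ?_
    filter_upwards [coeFn_toL2 g ψ] with m h
    rw [h]
    simp [mul_comm]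
  constructor
  · rintro ⟨w, hw, hw0, f, hf, hweak⟩
    let F : ℕ → smoothFunctions n M := fun j ↦ ⟨f j, hf.smooth j⟩
    refine ⟨hw.toLp, F, ⟨?_, ?_, hf.cauchy_energy, fun ψ ↦ ?_⟩⟩
    · intro h0
      have := hw.coeFn_toLp
      rw [h0] at this
      exact hw0 (this.symm.trans (Lp.coeFn_zero ℝ 2 (vol g)))
    · rw [Lp.tendsto_Lp_iff_tendsto_eLpNorm']
      refine hf.tendsto_L2.congr fun j ↦ eLpNorm_congr_ae ?_
      filter_upwards [coeFn_toL2 g (F j), hw.coeFn_toLp] with m h1 h2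
      rw [Pi.sub_apply, Pi.sub_apply, h1, h2]
    · rw [hinner]
      have : ∫ m, (hw.toLp) m * (ψ : M → ℝ) m ∂(vol g) =
          ∫ m, w m * (ψ : M → ℝ) m ∂(vol g) :=
        integral_congr_ae ((MemLp.coeFn_toLp hw).mul (ae_eq_refl _))
      rw [this]
      exact hweak ψ ψ.2
  · rintro ⟨w, f, h⟩
    refine ⟨w, Lp.memLp w, fun h0 ↦ h.ne_zero ((Lp.eq_zero_iff_ae_eq_zero).2 h0),
      fun j ↦ f j, ⟨fun j ↦ (f j).2, ?_, h.cauchy⟩, fun ψ hψ ↦ ?_⟩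
    · have := h.tendsto
      rw [Lp.tendsto_Lp_iff_tendsto_eLpNorm'] at this
      refine this.congr fun j ↦ eLpNorm_congr_ae ?_
      filter_upwards [coeFn_toL2 g (f j)] with m hm
      rw [Pi.sub_apply, Pi.sub_apply, hm]
    · have := h.weak ⟨ψ, hψ⟩
      rw [hinner] at this
      exact this

variable [T2Space M] [ConnectedSpace M]

theorem isLeast_rayleighInf (hn : 0 < n) (g : SmoothMetric n M) [IsFiniteMeasure (vol g)] :
    IsLeast (positiveEigenvalues g)
      (rayleighInf (toL2 g) (dirichletBilin g) (oneFunction n M)) := by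
  have h := isCompactForm hn g
  refine ⟨⟨h.rayleighInf_pos, (isLaplaceEigenvalue_iff g _).2 h.exists_eigenvector⟩, ?_⟩
  rintro lam ⟨hlam, hev⟩
  obtain ⟨w, f, hw⟩ := (isLaplaceEigenvalue_iff g _).1 hev
  exact h.rayleighInf_le_of_eigenvector hlam hw

theorem firstEigenvalue_eq (hn : 0 < n) (g : SmoothMetric n M) [IsFiniteMeasure (vol g)] :
    firstEigenvalue g = rayleighInf (toL2 g) (dirichletBilin g) (oneFunction n M) :=
  (isLeast_rayleighInf hn g).csInf_eq

/-- A function that is `1` on a large set and `0` on another one bounds the first eigenvalue. -/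
theorem firstEigenvalue_mul_le (hn : 0 < n) (g : SmoothMetric n M) [IsFiniteMeasure (vol g)]
    {f : M → ℝ} (hf : IsSmooth (n := n) f) {A B : Set M} (hA : MeasurableSet A)
    (hB : MeasurableSet B) (hfA : ∀ m ∈ A, f m = 1) (hfB : ∀ m ∈ B, f m = 0) {c : ℝ} (hc : 0 ≤ c)
    (hcA : c ≤ (vol g).real A) (hcB : c ≤ (vol g).real B) :
    firstEigenvalue g * (c / 2) ≤ ∫ m, gradInner g f f m ∂(vol g) := by
  have h := isCompactForm hn g
  let F : smoothFunctions n M := ⟨f, hf⟩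
  have hv : (vol g).real Set.univ ≠ 0 :=
    (ENNReal.toReal_pos (vol_pos_of_isOpen g isOpen_univ Set.univ_nonempty).ne'
      (measure_ne_top _ _)).ne'
  set a := (∫ m, f m ∂(vol g)) / (vol g).real Set.univ with ha
  have h1 := h.rayleighInf_le (F - a • oneFunction n M) (by
    rw [map_sub, map_smul, inner_sub_right, inner_smul_right, inner_one_toL2, inner_one_toL2]
    simp only [oneFunction, integral_const, smul_eq_mul, mul_one]
    rw [ha]
    field_simp
    ring)
  have e1 : dirichletBilin g (F - a • oneFunction n M) (F - a • oneFunction n M) =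
      ∫ m, gradInner g f f m ∂(vol g) := by
    simp only [map_sub, map_smul, LinearMap.sub_apply, LinearMap.smul_apply, h.one_left,
      h.symm _ (oneFunction n M), smul_zero, sub_zero]
    rfl
  rw [e1, norm_toL2_sq, ← firstEigenvalue_eq hn] at h1
  have hpos : 0 ≤ firstEigenvalue g := by
    rw [firstEigenvalue_eq hn]
    exact h.rayleighInf_nonneg
  refine le_trans ?_ h1
  gcongr
  have hcont : Continuous fun m ↦ (f m - a) ^ 2 := (hf.continuous.sub continuous_const).pow 2
  have hint := integrable_of_continuous g hcont
  have hAB : Disjoint A B := Set.disjoint_left.2 fun m hmA hmB ↦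
    one_ne_zero ((hfA m hmA).symm.trans (hfB m hmB))
  have e2 : ∫ m in A, (f m - a) ^ 2 ∂(vol g) = (vol g).real A * (1 - a) ^ 2 := by
    rw [setIntegral_congr_fun (g := fun _ ↦ (1 - a) ^ 2) hA fun m hm ↦ by simp [hfA m hm],
      setIntegral_const, smul_eq_mul]
  have e3 : ∫ m in B, (f m - a) ^ 2 ∂(vol g) = (vol g).real B * a ^ 2 := by
    rw [setIntegral_congr_fun (g := fun _ ↦ a ^ 2) hB fun m hm ↦ by simp [hfB m hm],
      setIntegral_const, smul_eq_mul]
  calc c / 2 ≤ c * (1 - a) ^ 2 + c * a ^ 2 := by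
        have : 0 ≤ c * (1 - 2 * a) ^ 2 := by positivity
        linarith
    _ ≤ (vol g).real A * (1 - a) ^ 2 + (vol g).real B * a ^ 2 := by gcongr
    _ = ∫ m in A ∪ B, (f m - a) ^ 2 ∂(vol g) := by
        rw [setIntegral_union hAB hB hint.integrableOn hint.integrableOn, e2, e3]
    _ ≤ ∫ m, (f m - a) ^ 2 ∂(vol g) :=
        setIntegral_le_integral hint (Eventually.of_forall fun m ↦ sq_nonneg _)
    _ = ∫ m, ((F - a • oneFunction n M : smoothFunctions n M) : M → ℝ) m ^ 2 ∂(vol g) := by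
        refine integral_congr_ae (Eventually.of_forall fun m ↦ ?_)
        change (f m - a) ^ 2 = (f m - a * 1) ^ 2
        rw [mul_one]

end FirstEigenvalue

/-! ### Geodesic balls in coordinates -/

section GeodesicBalls

variable {n : ℕ} {M : Type*} [TopologicalSpace M] [ChartedSpace (EuclideanSpace ℝ (Fin n)) M]
  [IsManifold (𝓡 n) ∞ M]

local notation "E" => EuclideanSpace ℝ (Fin n)
local notation "φ" => extChartAt (𝓡 n)

theorem geodesicBall_mono (g : SmoothMetric n M) (x : M) {ρ ρ' : ℝ} (h : ρ ≤ ρ') :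
    geodesicBall g x ρ ⊆ geodesicBall g x ρ' :=
  fun _ hq ↦ lt_of_lt_of_le hq (ENNReal.ofReal_le_ofReal h)

/-- A function whose gradient is bounded by `L` is `L`-Lipschitz for the distance of `g`. -/
theorem abs_sub_le_of_mem_geodesicBall (g : SmoothMetric n M) {f : M → ℝ}
    (hf : IsSmooth (n := n) f) {L : ℝ} (hL : 0 ≤ L) (hfL : ∀ m, gradInner g f f m ≤ L ^ 2)
    {x q : M} {ρ : ℝ} (hρ : 0 ≤ ρ) (hq : q ∈ geodesicBall g x ρ) : |f q - f x| ≤ L * ρ := by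
  let : RiemannianBundle (fun q : M ↦ TangentSpace (𝓡 n) q) := ⟨g.toRiemannianMetric⟩
  have hq' : riemannianEDist (𝓡 n) x q < ENNReal.ofReal ρ := hq
  obtain ⟨γ, h0, h1, hγ, hlen⟩ := exists_lt_of_riemannianEDist_lt hq'
  have hnorm : ∀ (m : M) (v : TangentSpace (𝓡 n) m),
      ‖differential (n := n) f m v‖ₑ ≤ ENNReal.ofReal L * ‖v‖ₑ := fun m v ↦ by
    rw [← ofReal_norm, ← ofReal_norm, ← ENNReal.ofReal_mul hL]
    refine ENNReal.ofReal_le_ofReal ?_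
    rw [Real.norm_eq_abs, norm_eq_sqrt_real_inner v]
    refine abs_le_of_sq_le_sq ?_ (by positivity)
    rw [mul_pow, Real.sq_sqrt real_inner_self_nonneg]
    refine (differential_sq_le g f m v).trans ?_
    refine mul_le_mul (hfL m) le_rfl ?_ (sq_nonneg L)
    exact real_inner_self_nonneg (x := v)
  have hfγ : ContDiffOn ℝ 1 (f ∘ γ) (Set.Icc 0 1) := by
    rw [← contMDiffOn_iff_contDiffOn]
    exact (ContMDiff.of_le hf (by simp)).comp_contMDiffOn hγ
  have key := enorm_sub_le_lintegral_derivWithin_Icc_of_contDiffOn_Icc hfγ zero_le_one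
  have hle : ‖f q - f x‖ₑ ≤ ENNReal.ofReal (L * ρ) := by
    rw [ENNReal.ofReal_mul hL]
    simp only [Function.comp, h0, h1] at key
    refine key.trans (le_trans ?_ (mul_le_mul' le_rfl hlen.le))
    rw [pathELength_eq_lintegral_mfderivWithin_Icc,
      ← lintegral_const_mul' _ _ ENNReal.ofReal_ne_top]
    refine setLIntegral_mono' measurableSet_Icc fun t ht ↦ ?_
    refine le_trans (le_of_eq ?_) (hnorm (γ t) _)
    have hu : UniqueMDiffWithinAt 𝓘(ℝ, ℝ) (Set.Icc (0 : ℝ) 1) t := by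
      rw [uniqueMDiffWithinAt_iff_uniqueDiffWithinAt]
      exact uniqueDiffOn_Icc zero_lt_one t ht
    have h2 := mfderiv_comp_mfderivWithin t (hf.mdifferentiableAt (γ t))
      (hγ.mdifferentiableOn one_ne_zero t ht) hu
    rw [mfderivWithin_eq_fderivWithin] at h2
    rw [← fderivWithin_derivWithin]
    exact congrArg (fun T : ℝ →L[ℝ] ℝ ↦ ‖T 1‖ₑ) h2
  rw [← ofReal_norm, Real.norm_eq_abs] at hle
  exact (ENNReal.ofReal_le_ofReal_iff (by positivity)).1 hle

/-- A coordinate ball is contained in a geodesic ball, because of the straight paths. -/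
theorem mem_geodesicBall_of_dist_lt (g : SmoothMetric n M) {p x q : M} {ρ Lam : ℝ}
    (hLam : 0 < Lam) (hx : x ∈ (φ p).source) (ht : Metric.ball (φ p x) ρ ⊆ (φ p).target)
    (hle : ∀ y ∈ Metric.ball (φ p x) ρ, ∀ a, coordForm g p y a a ≤ Lam * ‖a‖ ^ 2)
    (hq : q ∈ (φ p).source) (hqx : dist (φ p q) (φ p x) < ρ) :
    q ∈ geodesicBall g x (√Lam * ρ) := by
  let : RiemannianBundle (fun q : M ↦ TangentSpace (𝓡 n) q) := ⟨g.toRiemannianMetric⟩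
  change riemannianEDist (𝓡 n) x q < ENNReal.ofReal (√Lam * ρ)
  have hnorm : ∀ (m : M) (w : TangentSpace (𝓡 n) m),
      ‖w‖ₑ = ENNReal.ofReal (√(g.inner m w w)) := fun m w ↦ by
    rw [← ofReal_norm, norm_eq_sqrt_real_inner]
    rfl
  set v := φ p q - φ p x with hv
  let η : ℝ → E := fun t ↦ φ p x + t • v
  have hη : ContDiff ℝ 1 η := by fun_prop
  have hη' : ∀ t, HasFDerivAt η (ContinuousLinearMap.toSpanSingleton ℝ v) t := fun t ↦ by
    have := ((hasDerivAt_id t).smul_const v).const_add (φ p x)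
    rw [one_smul] at this
    exact this.hasFDerivAt
  have hηb : ∀ t ∈ Set.Icc (0 : ℝ) 1, η t ∈ Metric.ball (φ p x) ρ := fun t ht ↦ by
    have hρ : 0 < ρ := dist_nonneg.trans_lt hqx
    exact (convex_ball (φ p x) ρ).add_smul_sub_mem (Metric.mem_ball_self hρ)
      (Metric.mem_ball.2 hqx) ht
  have hγ : ContMDiffOn 𝓘(ℝ, ℝ) (𝓡 n) 1 ((φ p).symm ∘ η) (Set.Icc 0 1) :=
    ((contMDiffOn_extChartAt_symm (n := ∞) p).of_le (by norm_cast)).comp hη.contMDiff.contMDiffOn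
      fun t h ↦ ht (hηb t h)
  have h0 : ((φ p).symm ∘ η) 0 = x := by simp [η, (φ p).left_inv hx, -extChartAt]
  have h1 : ((φ p).symm ∘ η) 1 = q := by simp [η, hv, (φ p).left_inv hq, -extChartAt]
  refine (riemannianEDist_le_pathELength hγ h0 h1 zero_le_one).trans_lt ?_
  have hlen : pathELength (𝓡 n) ((φ p).symm ∘ η) 0 1 ≤
      ∫⁻ _t in Set.Icc (0 : ℝ) 1, ENNReal.ofReal (√Lam * ‖v‖) := by
    rw [pathELength_eq_lintegral_mfderivWithin_Icc]
    refine setLIntegral_mono' measurableSet_Icc fun t htI ↦ ?_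
    have hu : UniqueMDiffWithinAt 𝓘(ℝ, ℝ) (Set.Icc (0 : ℝ) 1) t := by
      rw [uniqueMDiffWithinAt_iff_uniqueDiffWithinAt]
      exact uniqueDiffOn_Icc zero_lt_one t htI
    have h2 := mfderiv_comp_mfderivWithin t (mdifferentiableAt_symm (p := p) (ht (hηb t htI)))
      (hη' t).differentiableAt.mdifferentiableAt.mdifferentiableWithinAt hu
    rw [mfderivWithin_eq_fderivWithin,
      (hη' t).hasFDerivWithinAt.fderivWithin (uniqueDiffOn_Icc zero_lt_one t htI)] at h2
    have h3 : mfderivWithin 𝓘(ℝ, ℝ) (𝓡 n) ((φ p).symm ∘ η) (Set.Icc 0 1) t 1 =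
        chartDeriv n p (η t) v := by
      rw [h2]
      change chartDeriv n p (η t) (ContinuousLinearMap.toSpanSingleton ℝ v (1 : ℝ)) = _
      rw [ContinuousLinearMap.toSpanSingleton_apply_one]
    rw [hnorm]
    refine ENNReal.ofReal_le_ofReal ?_
    have h4 : g.inner _ (mfderivWithin 𝓘(ℝ, ℝ) (𝓡 n) ((φ p).symm ∘ η) (Set.Icc 0 1) t 1)
        (mfderivWithin 𝓘(ℝ, ℝ) (𝓡 n) ((φ p).symm ∘ η) (Set.Icc 0 1) t 1) =
        coordForm g p (η t) v v :=
      congrArg (fun w : E ↦ g.inner ((φ p).symm (η t)) w w) h3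
    rw [h4]
    refine (Real.sqrt_le_sqrt (hle (η t) (hηb t htI) v)).trans_eq ?_
    rw [Real.sqrt_mul hLam.le, Real.sqrt_sq (norm_nonneg v)]
  refine hlen.trans_lt ?_
  rw [setLIntegral_const, Real.volume_Icc, sub_zero, ENNReal.ofReal_one, mul_one]
  rw [dist_eq_norm, ← hv] at hqx
  have : 0 < √Lam := Real.sqrt_pos.2 hLam
  exact (ENNReal.ofReal_lt_ofReal_iff (by have := norm_nonneg v; nlinarith)).2 (by gcongr)

end GeodesicBalls

/-! ### Conformal changes of the metric -/

section Conformal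

variable {n : ℕ} {M : Type*} [TopologicalSpace M] [ChartedSpace (EuclideanSpace ℝ (Fin n)) M]
  [IsManifold (𝓡 n) ∞ M]

local notation "E" => EuclideanSpace ℝ (Fin n)
local notation "φ" => extChartAt (𝓡 n)

/-- Under `g = a² g₀`, squared gradient lengths for `g₀` are `a²` times those for `g`. -/
theorem gradInner_of_conformal {g₀ g : SmoothMetric n M} {m : M} {a : ℝ}
    (hg : ∀ v w : TangentSpace (𝓡 n) m, g.inner m v w = a ^ 2 * g₀.inner m v w) (f : M → ℝ) :
    gradInner g₀ f f m = a ^ 2 * gradInner g f f m := by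
  rw [gradInner_eq g₀, ← inner_riemGrad g, hg, gradInner_eq g, ← inner_riemGrad g₀, g₀.symm]

/-- Under `g = a² g₀`, the volume density is multiplied by `|a|ⁿ`. -/
theorem sqrt_det_of_conformal {g₀ g : SmoothMetric n M} {p : M} {y : E} {a : ℝ}
    (hg : ∀ v w : TangentSpace (𝓡 n) ((φ p).symm y),
      g.inner ((φ p).symm y) v w = a ^ 2 * g₀.inner ((φ p).symm y) v w) :
    √(gramMatrix g p y).det = |a| ^ n * √(gramMatrix g₀ p y).det := by
  have h : gramMatrix g p y = a ^ 2 • gramMatrix g₀ p y := by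
    ext i j
    exact hg _ _
  rw [h, Matrix.det_smul, Fintype.card_fin, Real.sqrt_mul (by positivity), ← pow_mul, mul_comm 2 n,
    pow_mul, Real.sqrt_sq_eq_abs, abs_pow]

end Conformal

/-! ### Cutoff functions and the metric -/

section CutoffEnergy

variable {n : ℕ} {M : Type*} [TopologicalSpace M] [ChartedSpace (EuclideanSpace ℝ (Fin n)) M]
  [IsManifold (𝓡 n) ∞ M]

local notation "E" => EuclideanSpace ℝ (Fin n)
local notation "φ" => extChartAt (𝓡 n)

theorem gradInner_eq_zero_of_fderiv_eq_zero (g : SmoothMetric n M) {f : M → ℝ}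
    (hf : IsSmooth (n := n) f) {p m : M} (hm : m ∈ (φ p).source)
    (h : fderiv ℝ (f ∘ (φ p).symm) (φ p m) = 0) : gradInner g f f m = 0 := by
  have hy := (φ p).map_source hm
  obtain ⟨a, ha, -⟩ := exists_coord_grad g hy (hf.mdifferentiableAt ((φ p).symm (φ p m)))
  rw [← (φ p).left_inv hm, gradInner_eq, ha,
    differential_chartDeriv hy (hf.mdifferentiableAt ((φ p).symm (φ p m))), h]
  rfl

theorem gradInner_eq_zero_of_isLocalMin (g : SmoothMetric n M) {f : M → ℝ}
    (hf : IsSmooth (n := n) f) {m : M} (h : IsLocalMin f m) : gradInner g f f m = 0 := by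
  refine gradInner_eq_zero_of_fderiv_eq_zero g hf (mem_extChartAt_source (I := 𝓡 n) m) ?_
  refine IsLocalMin.fderiv_eq_zero ?_
  have hc := continuousAt_extChartAt_symm (I := 𝓡 n) m
  rw [ContinuousAt, extChartAt_to_inv] at hc
  filter_upwards [hc.eventually h] with y hy
  simpa only [Function.comp, extChartAt_to_inv] using hy

variable [T2Space M] {g : SmoothMetric n M} {p : M} {y₀ : EuclideanSpace ℝ (Fin n)} {s : ℝ}

/-- The gradient of the bump at scale `s` is supported in the annulus of radii `s` and `2 s`. -/
theorem gradInner_chartBump_eq_zero (hs : 0 < s)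
    (ht : Metric.closedBall y₀ (2 * s) ⊆ (φ p).target) {m : M}
    (hm : m ∉ (φ p).source ∩ φ p ⁻¹' (Metric.ball y₀ (2 * s) \ Metric.ball y₀ s)) :
    gradInner g (chartBump p y₀ s) (chartBump p y₀ s) m = 0 := by
  have hf := isSmooth_chartBump hs ht
  by_cases h : m ∈ (φ p).source ∧ dist (φ p m) y₀ < 2 * s
  · refine gradInner_eq_zero_of_fderiv_eq_zero g hf h.1
      (fderiv_chartBump_eq_zero hs ((φ p).map_source h.1) (Or.inl ?_))
    by_contra h'
    exact hm ⟨h.1, h.2, h'⟩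
  · refine gradInner_eq_zero_of_isLocalMin g hf (Eventually.of_forall fun q ↦ ?_)
    rw [chartBump_eq_zero hs h]
    exact chartBump_nonneg q

variable {r lam Lam c D C : ℝ}

theorem IsCoordinateBall.gradInner_chartBump_le (h : IsCoordinateBall g p r lam Lam c D)
    (hC : ∀ y, ‖fderiv ℝ (unitBump n) y‖ ≤ C) (hs : 0 < s)
    (hy₀ : Metric.closedBall y₀ (2 * s) ⊆ Metric.closedBall (φ p p) r) (m : M) :
    gradInner g (chartBump p y₀ s) (chartBump p y₀ s) m ≤ lam⁻¹ * (s⁻¹ * C) ^ 2 := by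
  have hlam := h.lam_pos
  have ht := hy₀.trans h.subset_target
  by_cases hm : m ∈ (φ p).source ∩ φ p ⁻¹' (Metric.ball y₀ (2 * s) \ Metric.ball y₀ s)
  · have hb := hy₀ (Metric.ball_subset_closedBall hm.2.1)
    have hy := (φ p).map_source hm.1
    have := gradInner_le_of_le_coordForm g hy
      ((isSmooth_chartBump hs ht).mdifferentiableAt ((φ p).symm (φ p m))) hlam
      (h.le_coordForm _ hb)
    rw [(φ p).left_inv hm.1, fderiv_chartBump hy, norm_smul, norm_inv,
      Real.norm_of_nonneg hs.le] at this
    refine this.trans ?_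
    have := hC (s⁻¹ • (φ p m - y₀))
    gcongr
  · rw [gradInner_chartBump_eq_zero hs ht hm]
    positivity

/-- A geodesic ball is contained in a coordinate ball of comparable radius, since the bump at the
scale of this radius is Lipschitz. -/
theorem IsCoordinateBall.mem_of_mem_geodesicBall (h : IsCoordinateBall g p r lam Lam c D)
    (hC : ∀ y, ‖fderiv ℝ (unitBump n) y‖ ≤ C) (hC0 : 0 < C) (hs : 0 < s) {x q : M}
    (hx : x ∈ (φ p).source)
    (hxb : Metric.closedBall (φ p x) (2 * s) ⊆ Metric.closedBall (φ p p) r)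
    (hq : q ∈ geodesicBall g x (√lam / (2 * C) * s)) :
    q ∈ (φ p).source ∧ dist (φ p q) (φ p x) < 2 * s := by
  have hlam := Real.sqrt_pos.2 h.lam_pos
  by_contra hn
  have h1 := abs_sub_le_of_mem_geodesicBall g
    (isSmooth_chartBump hs (hxb.trans h.subset_target)) (L := C / (√lam * s)) (by positivity)
    (fun m ↦ (h.gradInner_chartBump_le hC hs hxb m).trans_eq (by
      rw [div_pow, mul_pow (√lam), Real.sq_sqrt h.lam_pos.le]
      have := h.lam_pos
      field_simp)) (by positivity) hq
  rw [chartBump_eq_zero hs hn, chartBump_eq_one hs hx (by simpa using hs.le)] at h1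
  -- The bump drops from `1` to `0`, but it varies by at most `1 / 2` on the geodesic ball.
  have e : C / (√lam * s) * (√lam / (2 * C) * s) = 1 / 2 := by field_simp
  rw [e] at h1
  norm_num at h1

end CutoffEnergy

/-! ### Concentration in dimension four -/

section Concentration

variable {M : Type*} [TopologicalSpace M] [ChartedSpace (EuclideanSpace ℝ (Fin 4)) M]
  [IsManifold (𝓡 4) ∞ M]

local notation "E" => EuclideanSpace ℝ (Fin 4)
local notation "φ" => extChartAt (𝓡 4)

variable [T2Space M] [CompactSpace M] [MeasurableSpace M] [BorelSpace M]
  {g₀ g : SmoothMetric 4 M} {p : M} {y₀ : EuclideanSpace ℝ (Fin 4)}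
  {r lam Lam c D C s : ℝ}

omit [CompactSpace M] in
/-- The energy of a bump for a metric conformal to `g₀`. Since `∫ |df|⁴` is conformally invariant
and scale invariant in dimension four, only the volume of the annulus in which the gradient is
supported and a constant independent of the metric and of the scale enter. -/
theorem IsCoordinateBall.integral_gradInner_chartBump_le
    (h : IsCoordinateBall g₀ p r lam Lam c D) [IsFiniteMeasure (vol g)] {u : M → ℝ}
    (hu : ∀ m, 0 < u m)
    (hg : ∀ m, ∀ v w : TangentSpace (𝓡 4) m, g.inner m v w = u m ^ 2 * g₀.inner m v w)
    (hC : ∀ y, ‖fderiv ℝ (unitBump 4) y‖ ≤ C) (hs : 0 < s)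
    (hy₀ : Metric.closedBall y₀ (2 * s) ⊆ Metric.closedBall (φ p p) r) {δ : ℝ} (hδ : 0 < δ) :
    ∫ m, gradInner g (chartBump p y₀ s) (chartBump p y₀ s) m ∂(vol g) ≤
      δ⁻¹ * (vol g).real
        ((φ p).source ∩ φ p ⁻¹' (Metric.ball y₀ (2 * s) \ Metric.ball y₀ s)) +
      δ * (16 * lam⁻¹ ^ 2 * C ^ 4 * D * volume.real (Metric.ball (0 : E) 1)) := by
  have hlam := h.lam_pos
  have hD := h.D_pos
  have ht := hy₀.trans h.subset_target
  have hf := isSmooth_chartBump hs ht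
  set f := chartBump p y₀ s with hfdef
  set K : Set E := Metric.ball y₀ (2 * s) \ Metric.ball y₀ s with hK
  have hKm : MeasurableSet K := measurableSet_ball.diff measurableSet_ball
  have hKb : K ⊆ Metric.closedBall (φ p p) r := fun y hy ↦
    hy₀ (Metric.ball_subset_closedBall hy.1)
  have hKt := hKb.trans h.subset_target
  set A := (φ p).source ∩ φ p ⁻¹' K with hA
  have hAm : MeasurableSet A := measurableSet_source_inter p hKm
  set B := lam⁻¹ * (s⁻¹ * C) ^ 2 with hB
  have hB0 : 0 ≤ B := by positivity
  have hcont := continuous_gradInner g hf hf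
  have hpt : ∀ y ∈ K, ENNReal.ofReal (√(gramMatrix g p y).det) *
      ENNReal.ofReal (gradInner g f f ((φ p).symm y)) ≤
      ENNReal.ofReal δ⁻¹ * ENNReal.ofReal (√(gramMatrix g p y).det) +
        ENNReal.ofReal (δ * (D * B ^ 2)) := fun y hy ↦ by
    rw [← ENNReal.ofReal_mul (Real.sqrt_nonneg _), ← ENNReal.ofReal_mul (by positivity),
      ← ENNReal.ofReal_add (by positivity) (by positivity)]
    refine ENNReal.ofReal_le_ofReal ?_
    set m := (φ p).symm y
    set a := u m
    have ha := hu m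
    have h1 := sqrt_det_of_conformal (p := p) (y := y) (hg m)
    have h2 := gradInner_of_conformal (hg m) f
    have h3 := h.gradInner_chartBump_le hC hs hy₀ m
    have h4 := gradInner_self_nonneg g₀ f m
    have h5 := h.density_le y (hKb hy)
    set d := √(gramMatrix g₀ p y).det
    have hd : 0 ≤ d := Real.sqrt_nonneg _
    rw [h1, abs_of_pos ha]
    set G := gradInner g₀ f f m
    -- The inequality between the arithmetic and the geometric mean.
    have h6 : a ^ 2 * G ≤ δ⁻¹ * a ^ 4 + δ * G ^ 2 := by
      have e : δ⁻¹ * a ^ 4 + δ * G ^ 2 - a ^ 2 * G =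
          δ⁻¹ * ((a ^ 2 - δ * G / 2) ^ 2 + 3 / 4 * (δ * G) ^ 2) := by
        field_simp
        ring
      have : 0 ≤ δ⁻¹ * ((a ^ 2 - δ * G / 2) ^ 2 + 3 / 4 * (δ * G) ^ 2) := by positivity
      linarith
    calc a ^ 4 * d * gradInner g f f m = d * (a ^ 2 * G) := by rw [h2]; ring
      _ ≤ d * (δ⁻¹ * a ^ 4 + δ * G ^ 2) := by gcongr
      _ = δ⁻¹ * (a ^ 4 * d) + δ * (d * G ^ 2) := by ring
      _ ≤ δ⁻¹ * (a ^ 4 * d) + δ * (D * B ^ 2) := by gcongr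
  have hvolK : volume K ≤ ENNReal.ofReal ((2 * s) ^ 4 * volume.real (Metric.ball (0 : E) 1)) := by
    refine (measure_mono Set.sdiff_subset).trans_eq ?_
    rw [Measure.addHaar_ball volume y₀ (by positivity), ENNReal.ofReal_mul (by positivity),
      finrank_euclideanSpace, Fintype.card_fin, ofReal_measureReal measure_ball_lt_top.ne]
  have key : ∫⁻ m, ENNReal.ofReal (gradInner g f f m) ∂(vol g) ≤
      ENNReal.ofReal (δ⁻¹ * (vol g).real A +
        δ * (16 * lam⁻¹ ^ 2 * C ^ 4 * D * volume.real (Metric.ball (0 : E) 1))) := by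
    calc ∫⁻ m, ENNReal.ofReal (gradInner g f f m) ∂(vol g)
        = ∫⁻ m in A, ENNReal.ofReal (gradInner g f f m) ∂(vol g) := by
          refine (setLIntegral_eq_of_support_subset fun m hm ↦ ?_).symm
          by_contra hmA
          refine hm ?_
          change ENNReal.ofReal (gradInner g f f m) = 0
          rw [gradInner_chartBump_eq_zero hs ht hmA, ENNReal.ofReal_zero]
      _ = ∫⁻ y in K, ENNReal.ofReal (√(gramMatrix g p y).det) *
            ENNReal.ofReal (gradInner g f f ((φ p).symm y)) :=
          setLIntegral_vol g p hKm hKt hcont.measurable.ennreal_ofReal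
      _ ≤ ∫⁻ y in K, (ENNReal.ofReal δ⁻¹ * ENNReal.ofReal (√(gramMatrix g p y).det) +
            ENNReal.ofReal (δ * (D * B ^ 2))) := setLIntegral_mono' hKm hpt
      _ = ENNReal.ofReal δ⁻¹ * vol g A + ENNReal.ofReal (δ * (D * B ^ 2)) * volume K := by
          rw [lintegral_add_right _ measurable_const, lintegral_const_mul' _ _ ENNReal.ofReal_ne_top,
            ← vol_chart g p hKm hKt, setLIntegral_const]
      _ ≤ ENNReal.ofReal δ⁻¹ * ENNReal.ofReal ((vol g).real A) +
            ENNReal.ofReal (δ * (D * B ^ 2)) *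
              ENNReal.ofReal ((2 * s) ^ 4 * volume.real (Metric.ball (0 : E) 1)) := by
          rw [ofReal_measureReal]
          gcongr
      _ = _ := by
          rw [← ENNReal.ofReal_mul (by positivity), ← ENNReal.ofReal_mul (by positivity),
            ← ENNReal.ofReal_add (by positivity) (by positivity)]
          congr 2
          rw [hB]
          field_simp
          ring
  rw [integral_eq_lintegral_of_nonneg_ae (Eventually.of_forall fun m ↦
    gradInner_self_nonneg g f m) hcont.aestronglyMeasurable]
  refine ENNReal.toReal_le_of_le_ofReal ?_ key
  positivity

/-- Among `N` disjoint sets, one has at most the `N`-th part of the total mass. -/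
theorem exists_measureReal_le_inv {α : Type*} [MeasurableSpace α] (μ : Measure α)
    [IsProbabilityMeasure μ] {N : ℕ} (hN : 0 < N) {A : ℕ → Set α} (hA : ∀ i, MeasurableSet (A i))
    (hd : Pairwise (Function.onFun Disjoint A)) : ∃ i < N, μ.real (A i) ≤ (N : ℝ)⁻¹ := by
  have h1 : ∑ i ∈ Finset.range N, μ.real (A i) ≤ ∑ _i ∈ Finset.range N, (N : ℝ)⁻¹ := by
    rw [← measureReal_biUnion_finset (fun i _ j _ hij ↦ hd hij) fun i _ ↦ hA i]
    rw [Finset.sum_const, Finset.card_range, nsmul_eq_mul, mul_inv_cancel₀ (by positivity)]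
    exact measureReal_le_one
  obtain ⟨i, hi, h2⟩ := Finset.exists_le_of_sum_le (by simpa using hN.ne') h1
  exact ⟨i, Finset.mem_range.1 hi, h2⟩

variable [ConnectedSpace M]

/-- If both a coordinate ball and the complement of a concentric ball that is `2 ^ N` times as
large have volume at least `v`, then the first eigenvalue is small: one of the `N` dyadic annuli
in between has volume at most `1 / N`, and the bump in this annulus is a test function. -/
theorem IsCoordinateBall.firstEigenvalue_mul_le (h : IsCoordinateBall g₀ p r lam Lam c D)
    [IsProbabilityMeasure (vol g)] {u : M → ℝ} (hu : ∀ m, 0 < u m)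
    (hg : ∀ m, ∀ v w : TangentSpace (𝓡 4) m, g.inner m v w = u m ^ 2 * g₀.inner m v w)
    (hC : ∀ y, ‖fderiv ℝ (unitBump 4) y‖ ≤ C) (hs : 0 < s) {N : ℕ} (hN : 0 < N)
    (hy₀ : Metric.closedBall y₀ (2 ^ N * s) ⊆ Metric.closedBall (φ p p) r) {δ v : ℝ} (hδ : 0 < δ)
    (hv : 0 ≤ v)
    (hin : v ≤ (vol g).real ((φ p).source ∩ φ p ⁻¹' Metric.closedBall y₀ s))
    (hout : v ≤ (vol g).real ((φ p).source ∩ φ p ⁻¹' Metric.ball y₀ (2 ^ N * s))ᶜ) :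
    firstEigenvalue g * (v / 2) ≤ δ⁻¹ * (N : ℝ)⁻¹ +
      δ * (16 * lam⁻¹ ^ 2 * C ^ 4 * D * volume.real (Metric.ball (0 : E) 1)) := by
  obtain ⟨i, hi, hvol⟩ := exists_measureReal_le_inv (vol g) hN
    (A := fun i ↦ (φ p).source ∩ φ p ⁻¹'
      (Metric.ball y₀ (2 * (2 ^ i * s)) \ Metric.ball y₀ (2 ^ i * s)))
    (fun i ↦ measurableSet_source_inter p (measurableSet_ball.diff measurableSet_ball)) <| by
      refine (pairwise_disjoint_on _).2 fun i j hij ↦ ?_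
      refine Set.disjoint_left.2 fun m hm hm' ↦ hm'.2.2 ?_
      refine Metric.ball_subset_ball ?_ hm.2.1
      rw [← mul_assoc, ← pow_succ']
      gcongr
      · norm_num
      · exact hij
  have hs' : 0 < 2 ^ i * s := by positivity
  have hle : 2 * (2 ^ i * s) ≤ 2 ^ N * s := by
    rw [← mul_assoc, ← pow_succ']
    gcongr
    · norm_num
    · exact hi
  have hb := (Metric.closedBall_subset_closedBall hle).trans hy₀
  refine (ConformalPinching.firstEigenvalue_mul_le (by norm_num) g
    (isSmooth_chartBump hs' (hb.trans h.subset_target))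
    (measurableSet_source_inter p measurableSet_closedBall)
    (measurableSet_source_inter p measurableSet_ball).compl
    (fun m hm ↦ chartBump_eq_one hs' hm.1 (le_trans hm.2 ?_))
    (fun m hm ↦ chartBump_eq_zero hs' fun h' ↦ hm ⟨h'.1, h'.2.trans_le hle⟩) hv hin hout).trans
      ((h.integral_gradInner_chartBump_le hu hg hC hs' hb hδ).trans ?_)
  · exact le_mul_of_one_le_left hs.le (one_le_pow₀ one_le_two)
  · gcongr

end Concentration

/-! ### Sequences of conformal metrics -/

section Sequences

variable {M : Type*} [TopologicalSpace M] [ChartedSpace (EuclideanSpace ℝ (Fin 4)) M]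
  [IsManifold (𝓡 4) ∞ M]

local notation "φ" => extChartAt (𝓡 4)

/-- The error term of `IsCoordinateBall.firstEigenvalue_mul_le` can be made small, by choosing first
`δ` and then `N`. -/
theorem exists_inv_mul_inv_add_mul_le {K η : ℝ} (hK : 0 ≤ K) (hη : 0 < η) :
    ∃ δ > 0, ∃ N : ℕ, 0 < N ∧ δ⁻¹ * (N : ℝ)⁻¹ + δ * K ≤ η := by
  obtain ⟨N, hN⟩ := exists_nat_gt (4 * (K + 1) / η ^ 2)
  have hN0 : (0 : ℝ) < N := lt_trans (by positivity) hN
  refine ⟨η / (2 * (K + 1)), by positivity, N, by exact_mod_cast hN0, ?_⟩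
  have h1 : η / (2 * (K + 1)) * K ≤ η / 2 := by
    rw [div_mul_eq_mul_div, div_le_div_iff₀ (by positivity) two_pos]
    nlinarith
  have h2 : (η / (2 * (K + 1)))⁻¹ * (N : ℝ)⁻¹ ≤ η / 2 := by
    rw [inv_div, ← div_eq_mul_inv, div_div, div_le_div_iff₀ (by positivity) two_pos]
    rw [div_lt_iff₀ (by positivity)] at hN
    nlinarith
  linarith

variable [T2Space M] [CompactSpace M] [ConnectedSpace M] [MeasurableSpace M] [BorelSpace M]

/-- The first eigenvalue is small when the centre of concentration is close to a given point. -/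
theorem exists_nhds_eventually_firstEigenvalue_le {g₀ : SmoothMetric 4 M} {u : ℕ → M → ℝ}
    (hu : ∀ k m, 0 < u k m) {g : ℕ → SmoothMetric 4 M}
    (hg : ∀ k m, ∀ v w : TangentSpace (𝓡 4) m,
      (g k).inner m v w = u k m ^ 2 * g₀.inner m v w)
    [∀ k, IsProbabilityMeasure (vol (g k))] {x : ℕ → M} {r : ℕ → ℝ} (hr_pos : ∀ k, 0 < r k)
    (hr : Tendsto r atTop (𝓝 0)) {c : ℝ} (hc : 0 < c)
    (hinner : ∃ R > 0, ∀ᶠ k in atTop, c ≤ (vol (g k)).real (geodesicBall g₀ (x k) (R * r k)))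
    (houter : ∀ᶠ R in atTop, ∀ᶠ k in atTop,
      c ≤ (vol (g k)).real (geodesicBall g₀ (x k) (R * r k))ᶜ) {ε : ℝ} (hε : 0 < ε) (p : M) :
    ∃ U ∈ 𝓝 p, ∀ᶠ k in atTop, x k ∈ U → firstEigenvalue (g k) ≤ ε := by
  obtain ⟨ρ, lam, Lam, c₁, D, h⟩ := exists_isCoordinateBall g₀ p
  obtain ⟨C, hC0, hC⟩ := exists_norm_fderiv_unitBump_le (n := 4)
  obtain ⟨R₁, hR₁, hin⟩ := hinner
  have hlam := Real.sqrt_pos.2 h.lam_pos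
  have hLam := h.Lam_pos
  have hD := h.D_pos
  have hρ := h.r_pos
  obtain ⟨δ, hδ, N, hN, hδN⟩ := exists_inv_mul_inv_add_mul_le
    (K := 16 * lam⁻¹ ^ 2 * C ^ 4 * D * volume.real (Metric.ball (0 : EuclideanSpace ℝ (Fin 4)) 1))
    (η := ε * (c / 2)) (by positivity) (by positivity)
  -- The geodesic ball of radius `R₁ * r k` lies in the coordinate ball of radius `T * r k`.
  set T : ℝ := 2 * (R₁ / (√lam / (2 * C))) with hT
  have hT0 : 0 < T := by positivity
  obtain ⟨R₂, hR₂, hout⟩ := ((eventually_ge_atTop (√Lam * (2 ^ N * T))).and houter).exists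
  refine ⟨(φ p).source ∩ φ p ⁻¹' Metric.ball (φ p p) (ρ / 2),
    inter_mem (extChartAt_source_mem_nhds p) ((continuousAt_extChartAt p).preimage_mem_nhds
      (Metric.ball_mem_nhds _ (by positivity))), ?_⟩
  have hsmall : ∀ᶠ k in atTop, 2 ^ N * T * r k < ρ / 2 := by
    have h1 := hr.const_mul (2 ^ N * T)
    rw [mul_zero] at h1
    exact h1.eventually_lt_const (by positivity)
  filter_upwards [hin, hout, hsmall] with k hin hout hsmall ⟨hxs, hxb⟩
  have hrk := hr_pos k
  have hs : 0 < T * r k := by positivity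
  have hball : Metric.closedBall (φ p (x k)) (2 ^ N * (T * r k)) ⊆
      Metric.closedBall (φ p p) ρ := by
    refine Metric.closedBall_subset_closedBall' ?_
    have : dist (φ p (x k)) (φ p p) < ρ / 2 := hxb
    linarith
  have hpow : (1 : ℝ) ≤ 2 ^ N := one_le_pow₀ one_le_two
  have hTr : 2 * (R₁ / (√lam / (2 * C)) * r k) = T * r k := by rw [hT]; ring
  have h1 := h.firstEigenvalue_mul_le (hu k) (hg k) hC hs hN hball hδ hc.le
    (hin.trans (measureReal_mono fun q hq ↦ ?_)) (hout.trans (measureReal_mono fun q hq hq' ↦ ?_))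
  · exact le_of_mul_le_mul_right (h1.trans hδN) (by positivity)
  · have h2 := h.mem_of_mem_geodesicBall hC hC0 (s := R₁ / (√lam / (2 * C)) * r k) (q := q)
      (by positivity) hxs (by
        rw [hTr]
        exact (Metric.closedBall_subset_closedBall (le_mul_of_one_le_left hs.le hpow)).trans hball)
      (by
        convert hq using 2
        field_simp)
    exact ⟨h2.1, (h2.2.trans_eq hTr).le⟩
  · refine hq (geodesicBall_mono g₀ (x k) ?_ (mem_geodesicBall_of_dist_lt g₀ hLam hxs
      ((Metric.ball_subset_closedBall.trans hball).trans h.subset_target)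
      (fun y hy ↦ h.coordForm_le y (hball (Metric.ball_subset_closedBall hy))) hq'.1 hq'.2))
    calc √Lam * (2 ^ N * (T * r k)) = √Lam * (2 ^ N * T) * r k := by ring
      _ ≤ R₂ * r k := by gcongr

end Sequences
end ConformalPinching

end

theorem mainTheorem7
    {M : Type*} [TopologicalSpace M] [ChartedSpace (EuclideanSpace ℝ (Fin 4)) M]
    [IsManifold (𝓡 4) ∞ M] [CompactSpace M] [T2Space M] [ConnectedSpace M]
    [MeasurableSpace M] [BorelSpace M]
    (g₀ : ConformalPinching.SmoothMetric 4 M)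
    (u : ℕ → M → ℝ) (hu_smooth : ∀ k, ConformalPinching.IsSmooth (n := 4) (u k))
    (hu_pos : ∀ k p, 0 < u k p)
    (g : ℕ → ConformalPinching.SmoothMetric 4 M)
    (hg : ∀ k p, ∀ v w : TangentSpace (𝓡 4) p,
      (g k).inner p v w = (u k p) ^ 2 * g₀.inner p v w)
    (hvol : ∀ k, ConformalPinching.vol (g k) Set.univ = 1)
    (x : ℕ → M) (r : ℕ → ℝ) (hr_pos : ∀ k, 0 < r k) (hr : Tendsto r atTop (𝓝 0))
    (V₁ V₂ : ℝ≥0∞) (hV₁ : 0 < V₁) (hV₂ : 0 < V₂)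
    (hinner : Tendsto (fun R : ℝ ↦ liminf (fun k : ℕ ↦
      ConformalPinching.vol (g k)
        (ConformalPinching.geodesicBall g₀ (x k) (R * r k))) atTop) atTop (𝓝 V₁))
    (houter : Tendsto (fun R : ℝ ↦ liminf (fun k : ℕ ↦
      ConformalPinching.vol (g k)
        (ConformalPinching.geodesicBall g₀ (x k) (R * r k))ᶜ) atTop) atTop (𝓝 V₂)) :
    (∀ k, IsLeast (ConformalPinching.positiveEigenvalues (g k))
      (ConformalPinching.firstEigenvalue (g k))) ∧
    Tendsto (fun k ↦ ConformalPinching.firstEigenvalue (g k)) atTop (𝓝 0) := by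
  have hprob : ∀ k, IsProbabilityMeasure (ConformalPinching.vol (g k)) := fun k ↦ ⟨hvol k⟩
  refine ⟨fun k ↦ ?_, ?_⟩
  · rw [ConformalPinching.firstEigenvalue_eq (by norm_num) (g k)]
    exact ConformalPinching.isLeast_rayleighInf (by norm_num) (g k)
  obtain ⟨c, hc, hcV⟩ := ENNReal.lt_iff_exists_nnreal_btwn.1 (lt_min hV₁ hV₂)
  have hc : (0 : ℝ) < c := by exact_mod_cast hc
  have hreal : ∀ {A : ℕ → Set M},
      c < liminf (fun k ↦ ConformalPinching.vol (g k) (A k)) atTop →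
        ∀ᶠ k in atTop, (c : ℝ) ≤ (ConformalPinching.vol (g k)).real (A k) := fun {A} hA ↦ by
    filter_upwards [eventually_lt_of_lt_liminf hA] with k hk
    exact (ENNReal.toReal_mono (measure_ne_top _ _) hk.le)
  have hin : ∃ R > 0, ∀ᶠ k in atTop, (c : ℝ) ≤ (ConformalPinching.vol (g k)).real
      (ConformalPinching.geodesicBall g₀ (x k) (R * r k)) := by
    obtain ⟨R, hR, hR'⟩ := ((eventually_gt_atTop 0).and
      (hinner.eventually_const_lt (hcV.trans_le (min_le_left _ _)))).exists
    exact ⟨R, hR, hreal hR'⟩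
  have hout : ∀ᶠ R in atTop, ∀ᶠ k in atTop, (c : ℝ) ≤ (ConformalPinching.vol (g k)).real
      (ConformalPinching.geodesicBall g₀ (x k) (R * r k))ᶜ :=
    (houter.eventually_const_lt (hcV.trans_le (min_le_right _ _))).mono fun R hR ↦ hreal hR
  rw [Metric.tendsto_nhds]
  intro ε hε
  choose U hU hUε using ConformalPinching.exists_nhds_eventually_firstEigenvalue_le hu_pos hg
    hr_pos hr hc hin hout (half_pos hε)
  obtain ⟨t, -, ht⟩ := isCompact_univ.elim_nhds_subcover U fun p _ ↦ hU p
  filter_upwards [(eventually_all_finset t).2 fun p _ ↦ hUε p] with k hk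
  obtain ⟨p, hp, hxp⟩ := Set.mem_iUnion₂.1 (ht (Set.mem_univ (x k)))
  have h0 : 0 ≤ ConformalPinching.firstEigenvalue (g k) :=
    Real.sInf_nonneg fun _ hlam ↦ hlam.1.le
  rw [Real.dist_0_eq_abs, abs_of_nonneg h0]
  exact (hk p hp hxp).trans_lt (half_lt_self hε)
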